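/- Let $D\subset\mathbb R^d$ be open and bounded, and let $$\mathcal A u=-\sum_{i,j=1}^d a^{ij}(x)\,u_{x_ix_j}+\sum_{i=1}^d b^i(x)\,u_{x_i}+c(x)\,u,\qquad a^{ij},b^i,c\in C^\infty(\mathbb R^d),$$ considered on $H^2(D)\cap H_0^1(D)$, be symmetric in $L^2(D)$, uniformly elliptic on $D$ and positive definite ($\langle\mathcal A v,v\rangle_{L^2(D)}>0$ for $v\neq0$). Let $\alpha\in(1/2,1)$. Then there is a constant $C>0$, depending only on $D$, $\mathcal A$ and $\alpha$, with the following property. Let $(\lambda_n,\phi_n)_{n\ge1}$ be an eigensystem of $\mathcal A$, that is, $\phi_n\in H^2(D)\cap H^1_0(D)$, $\mathcal A\phi_n=\lambda_n\phi_n$, $\lambda_1\le\lambda_2\le\cdots$, and $\{\phi_n\}$ is an orthonormal basis of $L^2(D)$. Let $T>0$, $f,g\in L^2(D)$, $h\in L^\infty(0,T)$, and let $\mathbb W$ be a standard Wiener process on a probability space. Write $f_n=\langle f,\phi_n\rangle_{L^2(D)}$, $g_n=\langle g,\phi_n\rangle_{L^2(D)}$, $E_{\alpha,\alpha}(z)=\sum_{k\ge0}z^k/\Gamma(k\alpha+\alpha)$,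 and $$I_{n,1}(t)=f_n\int_0^t(t-\tau)^{\alpha-1}E_{\alpha,\alpha}(-\lambda_n(t-\tau)^\alpha)\,h(\tau)\,d\tau,\qquad I_{n,2}(t)=g_n\int_0^t(t-\tau)^{\alpha-1}E_{\alpha,\alpha}(-\lambda_n(t-\tau)^\alpha)\,d\mathbb W(\tau),$$ where the second integral is a Wiener integral. Then the mild solution $$u(\cdot,t)=\sum_{n=1}^\infty\bigl(I_{n,1}(t)+I_{n,2}(t)\bigr)\phi_n,\qquad t\in[0,T],$$ exists as a jointly measurable $L^2(D)$-valued process (for each $t$ the series converges in $L^2(D)$ almost surely), and every such process satisfies $$\mathbb E\|u\|^2_{L^2(D\times[0,T])}\le C\Bigl(\|h\|^2_{L^2(0,T)}\|f\|^2_{L^2(D)}+T^{2\alpha}\|g\|^2_{L^2(D)}\Bigr).$$ -/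

import Mathlib

open MeasureTheory ProbabilityTheory Filter Set
open scoped NNReal ENNReal Topology

noncomputable section

namespace SFDE

/-! ### Function spaces on a domain `D ⊆ ℝᵈ` -/

/-- `ℝᵈ` with its Euclidean norm. -/
abbrev Space (d : ℕ) : Type := EuclideanSpace ℝ (Fin d)

/-- The real Hilbert space `L²(D)`. -/
abbrev L2 {d : ℕ} (D : Set (Space d)) : Type := Lp ℝ 2 (volume.restrict D)

/-- Classical partial derivative `∂ψ/∂xᵢ`. -/
def partialDeriv {d : ℕ} (i : Fin d) (ψ : Space d → ℝ) (x : Space d) : ℝ :=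
  fderiv ℝ ψ x (EuclideanSpace.single i 1)

/-- `ψ ∈ C_c^∞(D)`. -/
structure IsTest {d : ℕ} (D : Set (Space d)) (ψ : Space d → ℝ) : Prop where
  smooth : ContDiff ℝ ((⊤ : ℕ∞) : WithTop ℕ∞) ψ
  compact : HasCompactSupport ψ
  support : tsupport ψ ⊆ D

/-- `v` is the weak partial derivative `∂u/∂xᵢ` on `D`. -/
def IsWeakPartial {d : ℕ} (D : Set (Space d)) (i : Fin d) (u v : L2 D) : Prop :=
  ∀ ψ : Space d → ℝ, IsTest D ψ →
    ∫ x in D, u x * partialDeriv i ψ x = - ∫ x in D, v x * ψ x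

/-- `u ∈ H¹₀(D)`: `u` is a limit of functions of `C_c^∞(D)` in the `H¹(D)` norm. -/
def MemH10 {d : ℕ} (D : Set (Space d)) (u : L2 D) : Prop :=
  ∃ (p : Fin d → L2 D) (ψ : ℕ → Space d → ℝ),
    (∀ i, IsWeakPartial D i u (p i)) ∧
    (∀ m, IsTest D (ψ m)) ∧
    Tendsto (fun m => eLpNorm (fun x => ψ m x - u x) 2 (volume.restrict D)) atTop (𝓝 0) ∧
    ∀ i, Tendsto (fun m => eLpNorm (fun x => partialDeriv i (ψ m) x - p i x) 2
      (volume.restrict D)) atTop (𝓝 0)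

/-! ### The elliptic operator -/

/-- Coefficients, smooth on `ℝᵈ`, of the operator
`𝒜u = -∑ aⁱʲ u_{xᵢxⱼ} + ∑ bⁱ u_{xᵢ} + c u`. -/
structure DiffOp (d : ℕ) where
  a : Fin d → Fin d → Space d → ℝ
  b : Fin d → Space d → ℝ
  c : Space d → ℝ
  smooth_a : ∀ i j, ContDiff ℝ ((⊤ : ℕ∞) : WithTop ℕ∞) (a i j)
  smooth_b : ∀ i, ContDiff ℝ ((⊤ : ℕ∞) : WithTop ℕ∞) (b i)
  smooth_c : ContDiff ℝ ((⊤ : ℕ∞) : WithTop ℕ∞) c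

/-- `A.Maps D u w`: `u` lies in the domain `H²(D) ∩ H¹₀(D)` of the operator, and `𝒜u = w`.
Here `p i`, `q i j` are the first and second weak derivatives of `u`. -/
def DiffOp.Maps {d : ℕ} (A : DiffOp d) (D : Set (Space d)) (u w : L2 D) : Prop :=
  MemH10 D u ∧
  ∃ (p : Fin d → L2 D) (q : Fin d → Fin d → L2 D),
    (∀ i, IsWeakPartial D i u (p i)) ∧
    (∀ i j, IsWeakPartial D j (p i) (q i j)) ∧
    ∀ᵐ x ∂(volume.restrict D),
      w x = -(∑ i, ∑ j, A.a i j x * q i j x) + (∑ i, A.b i x * p i x) + A.c x * u x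

/-- `𝒜`, with domain `H²(D) ∩ H¹₀(D)`, is symmetric, (uniformly) elliptic and positive definite. -/
structure DiffOp.IsSymmEllipticPosDef {d : ℕ} (A : DiffOp d) (D : Set (Space d)) : Prop where
  symm : ∀ u v Au Av : L2 D, A.Maps D u Au → A.Maps D v Av → inner ℝ Au v = inner ℝ u Av
  elliptic : ∃ θ : ℝ, 0 < θ ∧ ∀ x ∈ D, ∀ ξ : Space d,
    θ * ‖ξ‖ ^ 2 ≤ ∑ i, ∑ j, A.a i j x * ξ i * ξ j
  posDef : ∀ u Au : L2 D, A.Maps D u Au → u ≠ 0 → 0 < inner ℝ Au u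

/-- `(lam n, phi n)` is the eigensystem of `𝒜`: an orthonormal basis of `L²(D)` consisting of
eigenfunctions in `H²(D) ∩ H¹₀(D)`, listed in nondecreasing order of the eigenvalues. -/
structure DiffOp.IsEigensystem {d : ℕ} (A : DiffOp d) (D : Set (Space d))
    (lam : ℕ → ℝ) (phi : HilbertBasis ℕ ℝ (L2 D)) : Prop where
  mono : Monotone lam
  eigen : ∀ n, A.Maps D (phi n) (lam n • phi n)

/-! ### The Mittag-Leffler kernel -/

/-- The Mittag-Leffler function `E_{α,β}`, on the real line. -/
def mittagLeffler (α β z : ℝ) : ℝ := ∑' k : ℕ, z ^ k / Real.Gamma (k * α + β)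

/-- `s ↦ s^{α-1} E_{α,α}(-λ s^α)`. -/
def mlKernel (α lam s : ℝ) : ℝ := s ^ (α - 1) * mittagLeffler α α (-lam * s ^ α)

/-! ### The Wiener integral of a deterministic integrand -/

/-- A step function `∑ coefᵢ 1_{(leftᵢ, rightᵢ]}` on `(0, t]`. -/
structure StepFun (t : ℝ) where
  size : ℕ
  coef : Fin size → ℝ
  left : Fin size → ℝ
  right : Fin size → ℝ
  left_nonneg : ∀ i, 0 ≤ left i
  left_le_right : ∀ i, left i ≤ right i
  right_le : ∀ i, right i ≤ t

/-- The step function as a function of time. -/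
def StepFun.eval {t : ℝ} (s : StepFun t) (τ : ℝ) : ℝ :=
  ∑ i, (Ioc (s.left i) (s.right i)).indicator (fun _ => s.coef i) τ

/-- The elementary integral `∑ coefᵢ (W(rightᵢ) - W(leftᵢ))` of a step function. -/
def StepFun.integral {t : ℝ} {Ω : Type*} (s : StepFun t) (W : ℝ≥0 → Ω → ℝ) (ω : Ω) : ℝ :=
  ∑ i, s.coef i * (W (s.right i).toNNReal ω - W (s.left i).toNNReal ω)

/-- The random variable `X` is (a version of) the Wiener integral `∫₀ᵗ k(τ) dW(τ)` of
`k ∈ L²(0,t)`: the `L²(P)` limit of the elementary integrals of step functions converging to `k`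
in `L²(0,t)`. -/
def IsWienerIntegral {Ω : Type*} [MeasurableSpace Ω] (P : Measure Ω) (W : ℝ≥0 → Ω → ℝ)
    (t : ℝ) (k : ℝ → ℝ) (X : Ω → ℝ) : Prop :=
  MemLp k 2 (volume.restrict (Ioc 0 t)) ∧ MemLp X 2 P ∧
  ∃ s : ℕ → StepFun t,
    Tendsto (fun m => eLpNorm (fun τ => (s m).eval τ - k τ) 2 (volume.restrict (Ioc 0 t)))
      atTop (𝓝 0) ∧
    Tendsto (fun m => eLpNorm (fun ω => (s m).integral W ω - X ω) 2 P) atTop (𝓝 0)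

/-! ### The mild solution -/

/-- The deterministic coefficient
`I_{n,1}(t) = f_n ∫₀ᵗ (t-τ)^{α-1} E_{α,α}(-λ_n (t-τ)^α) h(τ) dτ`. -/
def detCoeff {d : ℕ} {D : Set (Space d)} (α : ℝ) (lam : ℕ → ℝ) (phi : HilbertBasis ℕ ℝ (L2 D))
    (f : L2 D) (h : ℝ → ℝ) (n : ℕ) (t : ℝ) : ℝ :=
  inner ℝ f (phi n) * ∫ τ in (0 : ℝ)..t, mlKernel α (lam n) (t - τ) * h τ

/-- The `L²(D)`-valued process `u` on `[0,T]` is (a jointly measurable version of) the mild solution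
`u(t) = ∑ₙ (I_{n,1}(t) + I_{n,2}(t)) φₙ`, with `I_{n,2}(t) = g_n J n t` and `J n t` the Wiener
integral `∫₀ᵗ (t-τ)^{α-1} E_{α,α}(-λ_n (t-τ)^α) dW(τ)`. The series converges in `L²(D)`, almost
surely for each time `t ∈ [0,T]`. -/
structure IsMildSolution {d : ℕ} {D : Set (Space d)} (α : ℝ) (lam : ℕ → ℝ)
    (phi : HilbertBasis ℕ ℝ (L2 D)) (T : ℝ) (f g : L2 D) (h : ℝ → ℝ)
    {Ω : Type*} [MeasurableSpace Ω] (P : Measure Ω) (W : ℝ≥0 → Ω → ℝ)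
    (u : ℝ → Ω → L2 D) : Prop where
  measurable : AEStronglyMeasurable (fun z : ℝ × Ω => u z.1 z.2)
    ((volume.restrict (Icc 0 T)).prod P)
  expansion : ∃ J : ℕ → ℝ → Ω → ℝ,
    (∀ n, ∀ t ∈ Icc 0 T,
      IsWienerIntegral P W t (fun τ => mlKernel α (lam n) (t - τ)) (J n t)) ∧
    ∀ t ∈ Icc 0 T, ∀ᵐ ω ∂P,
      HasSum (fun n => (detCoeff α lam phi f h n t + inner ℝ g (phi n) * J n t ω) • phi n) (u t ω)

/-- `𝔼‖u‖²_{L²(D×[0,T])}`, where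
`‖u(ω)‖_{L²(D×[0,T])}` is the norm of `t ↦ u(t, ω)` in `L²(0,T; L²(D)) = L²(D × [0,T])`. -/
def expectedSqNorm {d : ℕ} {D : Set (Space d)} (T : ℝ) {Ω : Type*} [MeasurableSpace Ω]
    (P : Measure Ω) (u : ℝ → Ω → L2 D) : ℝ≥0∞ :=
  ∫⁻ ω, (eLpNorm (fun t => u t ω) 2 (volume.restrict (Icc 0 T))) ^ 2 ∂P

end SFDE

end

open MeasureTheory ProbabilityTheory Filter Set
open scoped NNReal ENNReal Topology

noncomputable section

namespace SFDE

/-! ### The Mittag-Leffler function -/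

/-! Parseval in the eigenbasis reduces everything to the scalar kernels r(s) = s^(α-1) E_{α,α}(-λ
s^α), λ = λ_n. Two bounds suffice: r(s) ≤ s^(α-1)/Γ(α), and ∫₀ᵗ r ≤ 1/λ. Young's inequality and the
second bound control the drift coefficients by ‖h‖/λ; the Wiener isometry and the first bound
control the second moment of the noise coefficients by t^(2α-1)/((2α-1)Γ(α)²), where α > 1/2 is
needed. Integration over [0,T] turns the latter into a multiple of T^(2α).

Both kernel bounds rest on positivity of r (`mlKernel_pos`). Termwise Beta integrals show that r
solves r + λ a * r = a with a(t) = t^(α-1)/Γ(α), and a first-zero argument for this Volterra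
equation gives r > 0. Dropping the convolution gives the first bound. The second holds because 1 -
λ∫₀ᵗ r = E_{α,1}(-λ t^α) is, up to a positive factor, a fractional integral of r.

The constant is independent of the eigensystem since symmetry makes the lowest eigenvalue of one
eigensystem a lower bound for all others (`DiffOp.IsEigensystem.le`). For existence, the isometry
and continuity of translations in L² make each stochastic convolution mean-square continuous, hence
it has a jointly measurable version; a finite expected sum of squared coefficients then gives almost
sure convergence of the series at each time. -/

lemma rpow_mul_exp_le_Gamma {R x : ℝ} (hR : 0 < R) (hx : 0 < x) :
    Real.exp (-(R + 1)) * (R ^ x / (R + 1)) ≤ Real.Gamma x := by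
  rw [Real.Gamma_eq_integral hx]
  have h_int := Real.GammaIntegral_convergent hx
  -- Only the window (R, R+1] of Euler's integral is kept. As R is arbitrary, Γ outgrows every
  -- exponential.
  have hsub : Ioc R (R + 1) ⊆ Ioi (0 : ℝ) := fun u hu => hR.trans hu.1
  calc Real.exp (-(R + 1)) * (R ^ x / (R + 1))
      = ∫ _ in Ioc R (R + 1), Real.exp (-(R + 1)) * (R ^ x / (R + 1)) := by simp
    _ ≤ ∫ u in Ioc R (R + 1), Real.exp (-u) * u ^ (x - 1) := by
        refine setIntegral_mono_on (integrableOn_const (by simp)) (h_int.mono_set hsub) measurableSet_Ioc ?_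
        intro u hu
        have hu0 : 0 < u := hR.trans hu.1
        rw [Real.rpow_sub_one hu0.ne']
        have h1 : Real.exp (-(R + 1)) ≤ Real.exp (-u) := Real.exp_le_exp.2 (by linarith [hu.2])
        have h2 : R ^ x ≤ u ^ x := Real.rpow_le_rpow hR.le hu.1.le hx.le
        have h3 : R ^ x / (R + 1) ≤ u ^ x / u :=
          div_le_div₀ (by positivity) h2 hu0 hu.2
        gcongr
    _ ≤ ∫ u in Ioi 0, Real.exp (-u) * u ^ (x - 1) := by
        refine setIntegral_mono_set h_int ?_ hsub.eventuallyLE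
        filter_upwards [self_mem_ae_restrict measurableSet_Ioi] with u hu
        have : (0 : ℝ) < u := hu
        positivity

/-- Taking R with R^α = 2(|z|+1) in the lower bound for Γ gives a geometric majorant of ratio 1/2.
-/
lemma summable_mittagLeffler {α β : ℝ} (hα : 0 < α) (hβ : 0 < β) (z : ℝ) :
    Summable fun k : ℕ => z ^ k / Real.Gamma (k * α + β) := by
  set B : ℝ := 2 * (|z| + 1) with hB
  have hB0 : 0 < B := by positivity
  set R : ℝ := B ^ (1 / α) with hR
  have hR0 : 0 < R := by positivity
  have hRα : R ^ α = B := by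
    rw [hR, ← Real.rpow_mul hB0.le, one_div_mul_cancel hα.ne', Real.rpow_one]
  set M : ℝ := Real.exp (R + 1) * (R + 1) / R ^ β with hM
  refine Summable.of_norm_bounded (g := fun k : ℕ => M * (1 / 2 : ℝ) ^ k)
    (summable_geometric_two.mul_left M) fun k => ?_
  have hx : 0 < k * α + β := by positivity
  have hG := rpow_mul_exp_le_Gamma hR0 hx
  have hpow : R ^ (k * α + β) = B ^ k * R ^ β := by
    rw [Real.rpow_add hR0, mul_comm (k : ℝ) α, Real.rpow_mul hR0.le, hRα, Real.rpow_natCast]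
  have hpos : 0 < Real.exp (-(R + 1)) * (R ^ (k * α + β) / (R + 1)) := by positivity
  have hz : |z| ^ k ≤ (1 / 2 : ℝ) ^ k * B ^ k := by
    rw [← mul_pow]
    exact pow_le_pow_left₀ (abs_nonneg z) (by rw [hB]; linarith) k
  rw [norm_div, norm_pow, Real.norm_eq_abs, Real.norm_of_nonneg (Real.Gamma_pos_of_pos hx).le]
  calc |z| ^ k / Real.Gamma (k * α + β)
      ≤ ((1 / 2 : ℝ) ^ k * B ^ k) / (Real.exp (-(R + 1)) * (R ^ (k * α + β) / (R + 1))) := by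
        gcongr
    _ = M * (1 / 2 : ℝ) ^ k := by
        rw [hpow, hM, Real.exp_neg]
        field_simp

lemma continuous_mittagLeffler {α β : ℝ} (hα : 0 < α) (hβ : 0 < β) :
    Continuous (mittagLeffler α β) := by
  refine continuous_iff_continuousAt.2 fun z => ?_
  have h : ContinuousOn (mittagLeffler α β) (Metric.closedBall 0 (|z| + 1)) := by
    unfold mittagLeffler
    refine continuousOn_tsum (fun k => by fun_prop)
      (summable_mittagLeffler hα hβ (|z| + 1)) fun k x hx => ?_
    have hG := Real.Gamma_pos_of_pos (show 0 < k * α + β by positivity)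
    rw [norm_div, norm_pow, Real.norm_of_nonneg hG.le]
    have : ‖x‖ ≤ |z| + 1 := by simpa using hx
    gcongr
  refine h.continuousAt (Metric.closedBall_mem_nhds_of_mem ?_)
  simp

lemma mittagLeffler_zero {α β : ℝ} : mittagLeffler α β 0 = 1 / Real.Gamma β := by
  unfold mittagLeffler
  rw [tsum_eq_single 0]
  · simp
  · intro k hk
    simp [hk]

/-- Shifting the summation index raises the second parameter by α. Together with the fractional
integral formula, this yields the Volterra equation. -/
lemma mittagLeffler_eq_add_mul {α β : ℝ} (hα : 0 < α) (hβ : 0 < β) (z : ℝ) :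
    mittagLeffler α β z = 1 / Real.Gamma β + z * mittagLeffler α (β + α) z := by
  unfold mittagLeffler
  rw [(summable_mittagLeffler hα hβ z).tsum_eq_zero_add, ← tsum_mul_left]
  congr 1
  · simp
  · refine tsum_congr fun k => ?_
    rw [pow_succ', mul_div_assoc]
    congr 3
    push_cast
    ring

/-! ### Fractional integrals of Mittag-Leffler functions -/

lemma integral_rpow_mul_rpow {p q t : ℝ} (hp : 0 < p) (hq : 0 < q) (ht : 0 < t) :
    ∫ s in (0 : ℝ)..t, s ^ (q - 1) * (t - s) ^ (p - 1) =
      t ^ (q + p - 1) * (Real.Gamma q * Real.Gamma p / Real.Gamma (q + p)) := by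
  have h := Complex.betaIntegral_scaled (q : ℂ) (p : ℂ) ht
  rw [Complex.betaIntegral_eq_Gamma_mul_div _ _ (by simpa) (by simpa)] at h
  apply Complex.ofReal_injective
  rw [← intervalIntegral.integral_ofReal]
  push_cast
  rw [Complex.ofReal_cpow ht.le, ← Complex.Gamma_ofReal, ← Complex.Gamma_ofReal,
    ← Complex.Gamma_ofReal]
  push_cast
  rw [← h]
  refine intervalIntegral.integral_congr fun s hs => ?_
  rw [uIcc_of_le ht.le] at hs
  rw [Complex.ofReal_cpow hs.1, Complex.ofReal_cpow (by linarith [hs.2])]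
  push_cast
  rfl

lemma intervalIntegrable_rpow_mul_rpow {p q t : ℝ} (hp : 0 < p) (hq : 0 < q) (ht : 0 < t) :
    IntervalIntegrable (fun s => s ^ (q - 1) * (t - s) ^ (p - 1)) volume 0 t := by
  -- The integral of a non-integrable function is 0 by convention, whereas the Beta integral is
  -- positive.
  by_contra h
  have h1 := integral_rpow_mul_rpow hp hq ht
  rw [intervalIntegral.integral_undef h] at h1
  have := Real.Gamma_pos_of_pos hp
  have := Real.Gamma_pos_of_pos hq
  have := Real.Gamma_pos_of_pos (add_pos hq hp)
  have : 0 < t ^ (q + p - 1) * (Real.Gamma q * Real.Gamma p / Real.Gamma (q + p)) := by positivity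
  linarith

/-- The Riemann-Liouville integral of order `p` of `s ↦ s ^ (β - 1) * E_{α,β}(-λ s ^ α)`. -/
lemma integral_rpow_mul_mittagLeffler {α β p lam t : ℝ} (hα : 0 < α) (hβ : 0 < β) (hp : 0 < p)
    (ht : 0 < t) :
    IntervalIntegrable (fun s => (t - s) ^ (p - 1) * (s ^ (β - 1) *
      mittagLeffler α β (-lam * s ^ α))) volume 0 t ∧
    ∫ s in (0 : ℝ)..t, (t - s) ^ (p - 1) * (s ^ (β - 1) * mittagLeffler α β (-lam * s ^ α)) =
      Real.Gamma p * (t ^ (β + p - 1) * mittagLeffler α (β + p) (-lam * t ^ α)) := by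
  set F : ℕ → ℝ → ℝ := fun k s => (-lam) ^ k / Real.Gamma (k * α + β) *
    (s ^ ((k * α + β) - 1) * (t - s) ^ (p - 1)) with hF
  have hq : ∀ k : ℕ, 0 < k * α + β := fun k => by positivity
  have hFint : ∀ k, IntegrableOn (F k) (Ioc 0 t) := fun k =>
    (((intervalIntegrable_iff_integrableOn_Ioc_of_le ht.le).1
      (intervalIntegrable_rpow_mul_rpow hp (hq k) ht)).const_mul _)
  -- The base c is free: c = -λ gives the integrals of the terms, c = |λ| those of their absolute
  -- values, whose sum justifies exchanging series and integral.
  have hval : ∀ (c : ℝ) (k : ℕ), ∫ s in Ioc 0 t, c ^ k / Real.Gamma (k * α + β) *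
      (s ^ ((k * α + β) - 1) * (t - s) ^ (p - 1)) =
      Real.Gamma p * t ^ (β + p - 1) * ((c * t ^ α) ^ k / Real.Gamma (k * α + (β + p))) := by
    intro c k
    rw [integral_const_mul, ← intervalIntegral.integral_of_le ht.le,
      integral_rpow_mul_rpow hp (hq k) ht, mul_pow,
      show k * α + β + p - 1 = α * k + (β + p - 1) by ring, Real.rpow_add ht,
      Real.rpow_mul ht.le, Real.rpow_natCast, show k * α + β + p = k * α + (β + p) by ring]
    have := (Real.Gamma_pos_of_pos (hq k)).ne'
    have := (Real.Gamma_pos_of_pos (show 0 < k * α + (β + p) by positivity)).ne'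
    field_simp
  have hnorm : ∀ k, ∫ s in Ioc 0 t, ‖F k s‖ =
      Real.Gamma p * t ^ (β + p - 1) * ((|lam| * t ^ α) ^ k / Real.Gamma (k * α + (β + p))) := by
    intro k
    rw [← hval]
    refine setIntegral_congr_fun measurableSet_Ioc fun s hs => ?_
    have h1 : 0 ≤ s := hs.1.le
    have h2 : 0 ≤ t - s := by linarith [hs.2]
    simp only [hF]
    rw [norm_mul, norm_div, norm_pow, norm_neg, Real.norm_eq_abs,
      Real.norm_of_nonneg (Real.Gamma_pos_of_pos (hq k)).le, Real.norm_of_nonneg (by positivity)]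
  have hsumm : Summable fun k => ∫ s in Ioc 0 t, ‖F k s‖ := by
    simp_rw [hnorm]
    exact (summable_mittagLeffler hα (by positivity) _).mul_left _
  have hsum := hasSum_integral_of_summable_integral_norm hFint hsumm
  have hpt : ∀ s ∈ Ioc 0 t, ∑' k, F k s =
      (t - s) ^ (p - 1) * (s ^ (β - 1) * mittagLeffler α β (-lam * s ^ α)) := by
    intro s hs
    rw [mittagLeffler, ← tsum_mul_left, ← tsum_mul_left]
    refine tsum_congr fun k => ?_
    simp only [hF]
    rw [show k * α + β - 1 = α * k + (β - 1) by ring, Real.rpow_add hs.1,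
      Real.rpow_mul hs.1.le, Real.rpow_natCast, mul_pow]
    ring
  constructor
  · have hc : Continuous fun s : ℝ => mittagLeffler α β (-lam * s ^ α) :=
      (continuous_mittagLeffler hα hβ).comp
        (continuous_const.mul (Real.continuous_rpow_const hα.le))
    refine ((intervalIntegrable_rpow_mul_rpow hp hβ ht).mul_continuousOn hc.continuousOn).congr
      fun s _ => ?_
    ring
  · rw [intervalIntegral.integral_of_le ht.le, ← setIntegral_congr_fun measurableSet_Ioc hpt,
      ← hsum.tsum_eq, mittagLeffler, ← mul_assoc, ← tsum_mul_left]
    exact tsum_congr fun k => hval _ k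

/-! ### The kernel: Volterra equation, positivity, bounds -/

lemma continuousOn_mlKernel {α lam : ℝ} (hα : 0 < α) : ContinuousOn (mlKernel α lam) (Ioi 0) := by
  unfold mlKernel
  refine ContinuousOn.mul ?_ ?_
  · exact fun s hs => (Real.continuousAt_rpow_const s _ (Or.inl (ne_of_gt hs))).continuousWithinAt
  · refine (continuous_mittagLeffler hα hα).comp_continuousOn ?_
    refine continuousOn_const.mul ?_
    exact (Real.continuous_rpow_const hα.le).continuousOn

lemma measurable_mlKernel {α lam : ℝ} (hα : 0 < α) : Measurable (mlKernel α lam) := by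
  unfold mlKernel
  have := (continuous_mittagLeffler hα hα).measurable
  fun_prop

/-- The kernel `r` solves the Volterra equation `r + λ a * r = a` with `a(t) = t^(α-1)/Γ(α)`. -/
lemma mlKernel_volterra {α lam t : ℝ} (hα : 0 < α) (ht : 0 < t) :
    mlKernel α lam t + lam / Real.Gamma α *
      ∫ s in (0 : ℝ)..t, (t - s) ^ (α - 1) * mlKernel α lam s = t ^ (α - 1) / Real.Gamma α := by
  have h := (integral_rpow_mul_mittagLeffler (lam := lam) hα hα hα ht).2
  have hG := (Real.Gamma_pos_of_pos hα).ne'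
  unfold mlKernel
  rw [h, mittagLeffler_eq_add_mul hα hα (-lam * t ^ α),
    show α + α - 1 = α + (α - 1) by ring, Real.rpow_add ht]
  field_simp
  ring

lemma intervalIntegrable_rpow_mul_mlKernel {α p lam t : ℝ} (hα : 0 < α) (hp : 0 < p) (ht : 0 < t) :
    IntervalIntegrable (fun s => (t - s) ^ (p - 1) * mlKernel α lam s) volume 0 t :=
  (integral_rpow_mul_mittagLeffler hα hα hp ht).1

lemma mlKernel_pos_near_zero {α lam : ℝ} (hα : 0 < α) :
    ∃ ε > 0, ∀ s ∈ Ioo 0 ε, 0 < mlKernel α lam s := by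
  have hc : Continuous fun s : ℝ => mittagLeffler α α (-lam * s ^ α) :=
    (continuous_mittagLeffler hα hα).comp
      (continuous_const.mul (Real.continuous_rpow_const hα.le))
  have h0 : 0 < mittagLeffler α α (-lam * (0 : ℝ) ^ α) := by
    rw [Real.zero_rpow hα.ne', mul_zero, mittagLeffler_zero]
    exact one_div_pos.2 (Real.Gamma_pos_of_pos hα)
  obtain ⟨ε, hε, h⟩ := Metric.eventually_nhds_iff.1 (hc.continuousAt.eventually (lt_mem_nhds h0))
  refine ⟨ε, hε, fun s hs => mul_pos (Real.rpow_pos_of_pos hs.1 _) (h ?_)⟩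
  rw [Real.dist_eq, sub_zero, abs_of_pos hs.1]
  exact hs.2

/-- The kernel is positive: at a first zero `t₀` the Volterra equation would force a positive
value, because `(t₀ - s)^(α-1) ≤ (t₀/t)^(α-1) (t - s)^(α-1)` for `s < t < t₀`. -/
lemma mlKernel_pos {α lam : ℝ} (hα : 0 < α) (hα1 : α < 1) (hlam : 0 < lam) {t : ℝ} (ht : 0 < t) :
    0 < mlKernel α lam t := by
  by_contra hneg
  push Not at hneg
  set r := mlKernel α lam with hr
  have hG := Real.Gamma_pos_of_pos hα
  obtain ⟨ε, hε, hnear⟩ := mlKernel_pos_near_zero (lam := lam) hα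
  set Z : Set ℝ := {s | 0 < s ∧ r s ≤ 0} with hZ
  have hZne : Z.Nonempty := ⟨t, ht, hneg⟩
  have hZε : ∀ s ∈ Z, ε ≤ s := fun s hs => by
    by_contra hlt
    exact absurd (hnear s ⟨hs.1, not_le.1 hlt⟩) (not_lt.2 hs.2)
  have hZb : BddBelow Z := ⟨ε, hZε⟩
  set t0 := sInf Z with ht0
  have ht0ε : ε ≤ t0 := le_csInf hZne hZε
  have ht0pos : 0 < t0 := hε.trans_le ht0ε
  have hcont : ∀ s, 0 < s → ContinuousAt r s := fun s hs =>
    (continuousOn_mlKernel hα).continuousAt (Ioi_mem_nhds hs)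
  have hrt0 : r t0 ≤ 0 := by
    by_contra hpos
    push Not at hpos
    obtain ⟨δ, hδ, h⟩ := Metric.eventually_nhds_iff.1
      ((hcont t0 ht0pos).eventually (lt_mem_nhds hpos))
    obtain ⟨s, hsZ, hs⟩ := exists_lt_of_csInf_lt hZne (show sInf Z < t0 + δ by linarith)
    have hs0 : t0 ≤ s := csInf_le hZb hsZ
    have := h (show dist s t0 < δ by rw [Real.dist_eq, abs_of_nonneg (by linarith)]; linarith)
    exact absurd hsZ.2 (not_le.2 this)
  have hpos : ∀ s, 0 < s → s < t0 → 0 < r s := fun s hs hst => by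
    by_contra hle
    exact absurd (csInf_le hZb (show s ∈ Z from ⟨hs, not_lt.1 hle⟩)) (not_le.2 hst)
  set κ := lam / Real.Gamma α with hκ
  have hκ0 : 0 < κ := by positivity
  -- The window [t₀ - δ, t₀] is so short that the convolution over it costs less than half the
  -- maximum of r there; δ < t₀/2 keeps t₀/t' ≤ 2 for every t' in it.
  obtain ⟨δ, hδ0, hδt, hδ⟩ : ∃ δ > 0, δ < t0 / 2 ∧ κ * (δ ^ α / α) < 1 / 2 := by
    have hc : ContinuousAt (fun δ : ℝ => κ * (δ ^ α / α)) 0 :=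
      (continuous_const.mul
        ((Real.continuous_rpow_const hα.le).div_const α)).continuousAt
    have h0 : κ * ((0 : ℝ) ^ α / α) < 1 / 2 := by
      rw [Real.zero_rpow hα.ne']; norm_num
    obtain ⟨η, hη, h⟩ := Metric.eventually_nhds_iff.1 (hc.eventually (gt_mem_nhds h0))
    refine ⟨min (η / 2) (t0 / 4), by positivity, ?_, h ?_⟩
    · exact (min_le_right _ _).trans_lt (by linarith)
    · rw [Real.dist_eq, sub_zero, abs_of_pos (by positivity)]
      exact (min_le_left _ _).trans_lt (by linarith)
  obtain ⟨t', ht', hmax⟩ := isCompact_Icc.exists_isMaxOn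
    (nonempty_Icc.2 (show t0 - δ ≤ t0 by linarith))
    (fun s hs => (hcont s (by linarith [hs.1])).continuousWithinAt : ContinuousOn r (Icc (t0 - δ) t0))
  have hrt' : 0 < r t' :=
    (hpos (t0 - δ) (by linarith) (by linarith)).trans_le (hmax ⟨le_rfl, by linarith⟩)
  have ht'0 : 0 < t' := by linarith [ht'.1]
  have ht't0 : t' < t0 := lt_of_le_of_ne ht'.2 fun h => by rw [h] at hrt'; linarith
  have hV0 := mlKernel_volterra (lam := lam) hα ht0pos
  have hV := mlKernel_volterra (lam := lam) hα ht'0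
  have hI0 := intervalIntegrable_rpow_mul_mlKernel (lam := lam) hα hα ht0pos
  have hI := intervalIntegrable_rpow_mul_mlKernel (lam := lam) hα hα ht'0
  rw [← hr] at hV hV0 hI hI0
  have hI1 : IntervalIntegrable (fun s => (t0 - s) ^ (α - 1) * r s) volume 0 t' :=
    hI0.mono_set (by rw [uIcc_of_le ht'0.le, uIcc_of_le ht0pos.le]; exact Icc_subset_Icc_right ht't0.le)
  have hI2 : IntervalIntegrable (fun s => (t0 - s) ^ (α - 1) * r s) volume t' t0 :=
    hI0.mono_set (by rw [uIcc_of_le ht't0.le, uIcc_of_le ht0pos.le]; exact Icc_subset_Icc_left ht'0.le)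
  rw [← intervalIntegral.integral_add_adjacent_intervals hI1 hI2] at hV0
  have hA : ∫ s in (0 : ℝ)..t', (t0 - s) ^ (α - 1) * r s ≤
      (t0 / t') ^ (α - 1) * ∫ s in (0 : ℝ)..t', (t' - s) ^ (α - 1) * r s := by
    rw [← intervalIntegral.integral_const_mul]
    refine intervalIntegral.integral_mono_on_of_le_Ioo ht'0.le hI1 (hI.const_mul _) fun s hs => ?_
    rw [← mul_assoc]
    refine mul_le_mul_of_nonneg_right ?_ (hpos s hs.1 (hs.2.trans ht't0)).le
    have h1 : 0 < t' - s := by linarith [hs.2]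
    rw [← Real.mul_rpow (by positivity) h1.le]
    refine Real.rpow_le_rpow_of_nonpos (by positivity) ?_ (by linarith)
    rw [div_mul_eq_mul_div, div_le_iff₀ ht'0]
    nlinarith [hs.1]
  have hB : ∫ s in t'..t0, (t0 - s) ^ (α - 1) * r s ≤ r t' * ((t0 - t') ^ α / α) := by
    have hval : ∫ s in t'..t0, (t0 - s) ^ (α - 1) = (t0 - t') ^ α / α := by
      rw [intervalIntegral.integral_comp_sub_left (fun x => x ^ (α - 1)), sub_self,
        integral_rpow (Or.inl (by linarith)), sub_add_cancel, Real.zero_rpow hα.ne', sub_zero]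
    have hii : IntervalIntegrable (fun s : ℝ => (t0 - s) ^ (α - 1)) volume t' t0 := by
      have := (intervalIntegral.intervalIntegrable_rpow' (a := t0 - t') (b := 0)
        (show -1 < α - 1 by linarith)).comp_sub_left t0
      simpa using this
    rw [← hval, mul_comm, ← intervalIntegral.integral_mul_const]
    refine intervalIntegral.integral_mono_on ht't0.le hI2 (hii.mul_const _) fun s hs => ?_
    have h1 : 0 ≤ t0 - s := by linarith [hs.2]
    exact mul_le_mul_of_nonneg_left (hmax ⟨ht'.1.trans hs.1, hs.2⟩) (by positivity)
  -- From t₀/t' ≤ 2 and -1 ≤ α - 1 < 0.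
  have hratio : 1 / 2 ≤ (t0 / t') ^ (α - 1) := by
    have h2 : t0 / t' ≤ 2 := by rw [div_le_iff₀ ht'0]; linarith [ht'.1]
    calc (1 / 2 : ℝ) = 2 ^ (-1 : ℝ) := by rw [Real.rpow_neg_one]; norm_num
      _ ≤ 2 ^ (α - 1) := Real.rpow_le_rpow_of_exponent_le (by norm_num) (by linarith)
      _ ≤ (t0 / t') ^ (α - 1) := Real.rpow_le_rpow_of_nonpos (by positivity) h2 (by linarith)
  have hδ' : κ * ((t0 - t') ^ α / α) < 1 / 2 := by
    refine lt_of_le_of_lt ?_ hδ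
    have h1 : (t0 - t') ^ α ≤ δ ^ α :=
      Real.rpow_le_rpow (by linarith) (by linarith [ht'.1]) hα.le
    gcongr
  have hsplit : t0 ^ (α - 1) = (t0 / t') ^ (α - 1) * t' ^ (α - 1) := by
    rw [← Real.mul_rpow (by positivity) ht'0.le, div_mul_cancel₀ _ ht'0.ne']
  -- With q = (t₀/t')^(α-1), subtracting q times the equation at t' from the one at t₀ gives r(t₀) ≥
  -- (q - κ (t₀-t')^α/α) r(t') > 0, against r(t₀) ≤ 0.
  rw [hsplit, mul_div_assoc, ← hV] at hV0
  have hA' := mul_le_mul_of_nonneg_left hA hκ0.le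
  have hB' := mul_le_mul_of_nonneg_left hB hκ0.le
  nlinarith

lemma mlKernel_le {α lam : ℝ} (hα : 0 < α) (hα1 : α < 1) (hlam : 0 < lam) {t : ℝ} (ht : 0 < t) :
    mlKernel α lam t ≤ t ^ (α - 1) / Real.Gamma α := by
  rw [← mlKernel_volterra (lam := lam) hα ht]
  have h : 0 ≤ ∫ s in (0 : ℝ)..t, (t - s) ^ (α - 1) * mlKernel α lam s := by
    rw [intervalIntegral.integral_of_le ht.le]
    refine setIntegral_nonneg measurableSet_Ioc fun s hs => ?_
    have h1 : 0 ≤ t - s := by linarith [hs.2]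
    exact mul_nonneg (Real.rpow_nonneg h1 _) (mlKernel_pos hα hα1 hlam hs.1).le
  have := Real.Gamma_pos_of_pos hα
  have : 0 ≤ lam / Real.Gamma α := by positivity
  nlinarith

lemma intervalIntegrable_mlKernel {α lam t : ℝ} (hα : 0 < α) (ht : 0 < t) :
    IntervalIntegrable (mlKernel α lam) volume 0 t := by
  simpa using intervalIntegrable_rpow_mul_mlKernel (lam := lam) hα one_pos ht

/-- The integral is t^α E_{α,α+1}(-λ t^α) = (1 - E_{α,1}(-λ t^α))/λ. Here E_{α,1} is nonnegative,
since Γ(1-α) E_{α,1} is the convolution of r with s^(-α). -/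
lemma integral_mlKernel_le {α lam : ℝ} (hα : 0 < α) (hα1 : α < 1) (hlam : 0 < lam) {t : ℝ}
    (ht : 0 < t) : ∫ s in (0 : ℝ)..t, mlKernel α lam s ≤ 1 / lam := by
  have h1 := (integral_rpow_mul_mittagLeffler (lam := lam) hα hα one_pos ht).2
  have h2 := (integral_rpow_mul_mittagLeffler (lam := lam) hα hα
    (show 0 < 1 - α by linarith) ht).2
  have hnn : 0 ≤ ∫ s in (0 : ℝ)..t, (t - s) ^ (1 - α - 1) * (s ^ (α - 1) *
      mittagLeffler α α (-lam * s ^ α)) := by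
    rw [intervalIntegral.integral_of_le ht.le]
    refine setIntegral_nonneg measurableSet_Ioc fun s hs => ?_
    have h1 : 0 ≤ t - s := by linarith [hs.2]
    exact mul_nonneg (Real.rpow_nonneg h1 _) (mlKernel_pos hα hα1 hlam hs.1).le
  rw [h2, add_sub_cancel, sub_self, Real.rpow_zero, one_mul] at hnn
  have hE : 0 ≤ mittagLeffler α 1 (-lam * t ^ α) :=
    nonneg_of_mul_nonneg_right hnn (Real.Gamma_pos_of_pos (by linarith))
  rw [mittagLeffler_eq_add_mul hα one_pos, Real.Gamma_one] at hE
  simp only [sub_self, Real.rpow_zero, one_mul, Real.Gamma_one, add_sub_cancel_right] at h1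
  unfold mlKernel
  rw [h1, le_div_iff₀ hlam, add_comm α 1]
  nlinarith


section

/-! ### The Wiener integral -/

/-! ### Second moments and limits in L² -/

section Lp

variable {X Y : Type*} [MeasurableSpace X] [MeasurableSpace Y] {μ : Measure X} {ν : Measure Y}

lemma eLpNorm_two_sq (f : X → ℝ) : eLpNorm f 2 μ ^ 2 = ∫⁻ x, ‖f x‖ₑ ^ 2 ∂μ := by
  have h := eLpNorm_nnreal_pow_eq_lintegral (f := f) (μ := μ) (p := 2) (by norm_num)
  simpa using h

lemma lintegral_enorm_sq_eq_ofReal {f : X → ℝ} (hf : MemLp f 2 μ) :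
    ∫⁻ x, ‖f x‖ₑ ^ 2 ∂μ = ENNReal.ofReal (∫ x, f x * f x ∂μ) := by
  have h_int : Integrable (fun x => f x * f x) μ := hf.integrable_mul hf
  rw [ofReal_integral_eq_lintegral_ofReal h_int (ae_of_all _ fun z => mul_self_nonneg _)]
  refine lintegral_congr fun z => ?_
  rw [← Real.enorm_of_nonneg (mul_self_nonneg _), ← pow_two, enorm_pow]

lemma eLpNorm_two_eq_of_integral_sq_eq {f : X → ℝ} {g : Y → ℝ} (hf : MemLp f 2 μ)
    (hg : MemLp g 2 ν) (h : ∫ x, f x * f x ∂μ = ∫ y, g y * g y ∂ν) :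
    eLpNorm f 2 μ = eLpNorm g 2 ν := by
  have h2 : eLpNorm f 2 μ ^ 2 = eLpNorm g 2 ν ^ 2 := by
    rw [eLpNorm_two_sq, eLpNorm_two_sq, lintegral_enorm_sq_eq_ofReal hf,
      lintegral_enorm_sq_eq_ofReal hg, h]
  exact (ENNReal.pow_right_strictMono two_ne_zero).injective h2

lemma integral_sum_mul_sum {ι : Type*} [Fintype ι] (c : ι → ℝ) {f : ι → X → ℝ}
    (hf : ∀ i, MemLp (f i) 2 μ) :
    ∫ x, (∑ i, c i * f i x) * (∑ i, c i * f i x) ∂μ =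
      ∑ i, ∑ j, c i * c j * ∫ x, f i x * f j x ∂μ := by
  have h_int : ∀ i j, Integrable (fun x => c i * c j * (f i x * f j x)) μ := fun i j =>
    ((hf i).integrable_mul (hf j)).const_mul _
  calc ∫ x, (∑ i, c i * f i x) * (∑ i, c i * f i x) ∂μ
      = ∫ x, ∑ i, ∑ j, c i * c j * (f i x * f j x) ∂μ := by
        refine integral_congr_ae (ae_of_all _ fun x => ?_)
        simp only [Finset.sum_mul_sum]
        exact Finset.sum_congr rfl fun i _ => Finset.sum_congr rfl fun j _ => by ring
    _ = _ := by
        rw [integral_finsetSum _ fun i _ => integrable_finsetSum _ fun j _ => h_int i j]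
        refine Finset.sum_congr rfl fun i _ => ?_
        rw [integral_finsetSum _ fun j _ => h_int i j]
        exact Finset.sum_congr rfl fun j _ => integral_const_mul _ _

/-- Used on both sides of the isometry to pass from step functions to their L² limits. -/
lemma tendsto_eLpNorm_sub {f g : ℕ → X → ℝ} {F G : X → ℝ} (hf : ∀ m, MemLp (f m) 2 μ)
    (hg : ∀ m, MemLp (g m) 2 μ) (hF : MemLp F 2 μ) (hG : MemLp G 2 μ)
    (hfF : Tendsto (fun m => eLpNorm (fun x => f m x - F x) 2 μ) atTop (𝓝 0))
    (hgG : Tendsto (fun m => eLpNorm (fun x => g m x - G x) 2 μ) atTop (𝓝 0)) :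
    Tendsto (fun m => eLpNorm (fun x => f m x - g m x) 2 μ) atTop
      (𝓝 (eLpNorm (fun x => F x - G x) 2 μ)) := by
  have h1 := (Lp.tendsto_Lp_iff_tendsto_eLpNorm'' f hf F hF).2 hfF
  have h2 := (Lp.tendsto_Lp_iff_tendsto_eLpNorm'' g hg G hG).2 hgG
  have h3 := (h1.sub h2).enorm
  simp_rw [← MemLp.toLp_sub, Lp.enorm_toLp] at h3
  exact h3

end Lp

variable {Ω : Type*} [MeasurableSpace Ω] {P : Measure Ω} {W : ℝ≥0 → Ω → ℝ}

lemma memLp_brownian (hW : IsBrownianReal W P) (t : ℝ≥0) : MemLp (W t) 2 P :=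
  (hW.isGaussianProcess.hasGaussianLaw_eval t).memLp_two

lemma integral_brownian_mul [IsProbabilityMeasure P] (hW : IsBrownianReal W P) (s t : ℝ≥0) :
    ∫ ω, W s ω * W t ω ∂P = min (s : ℝ) t := by
  have h := covariance_eq_sub (memLp_brownian hW s) (memLp_brownian hW t)
  rw [hW.covariance_eval, hW.integral_eval, zero_mul, sub_zero] at h
  rw [← NNReal.coe_min, h]
  rfl

/-- Both sides are the length of (a,b] ∩ (c,d]; on the left this comes from the covariance min(s,t).
-/
lemma integral_increment_mul_increment [IsProbabilityMeasure P] (hW : IsBrownianReal W P)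
    {a b c d : ℝ} (ha : 0 ≤ a) (hab : a ≤ b) (hc : 0 ≤ c) (hcd : c ≤ d) :
    ∫ ω, (W b.toNNReal ω - W a.toNNReal ω) * (W d.toNNReal ω - W c.toNNReal ω) ∂P =
      ∫ x, (Ioc a b).indicator (fun _ => (1 : ℝ)) x * (Ioc c d).indicator (fun _ => (1 : ℝ)) x := by
  have h_int : ∀ s t : ℝ≥0, Integrable (fun ω => W s ω * W t ω) P := fun s t =>
    (memLp_brownian hW s).integrable_mul (memLp_brownian hW t)
  have hl : ∫ ω, (W b.toNNReal ω - W a.toNNReal ω) * (W d.toNNReal ω - W c.toNNReal ω) ∂P =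
      min b d - min b c - (min a d - min a c) := by
    simp_rw [sub_mul, mul_sub]
    have h_int' : ∀ s t u : ℝ≥0, Integrable (fun ω => W s ω * W t ω - W s ω * W u ω) P :=
      fun s t u => (h_int s t).sub (h_int s u)
    rw [integral_sub (h_int' _ _ _) (h_int' _ _ _),
      integral_sub (h_int _ _) (h_int _ _), integral_sub (h_int _ _) (h_int _ _)]
    simp only [integral_brownian_mul hW]
    rw [Real.coe_toNNReal a ha, Real.coe_toNNReal b (ha.trans hab), Real.coe_toNNReal c hc,
      Real.coe_toNNReal d (hc.trans hcd)]
  have hr : ∀ x, (Ioc a b).indicator (fun _ => (1 : ℝ)) x *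
      (Ioc c d).indicator (fun _ => (1 : ℝ)) x =
      (Ioc (max a c) (min b d)).indicator (fun _ => (1 : ℝ)) x := fun x => by
    rw [← Ioc_inter_Ioc]
    by_cases h1 : x ∈ Ioc a b <;> by_cases h2 : x ∈ Ioc c d <;> simp [indicator, h1, h2, -mem_Ioc]
  simp_rw [hr]
  rw [hl, integral_indicator measurableSet_Ioc]
  simp only [integral_const, MeasurableSet.univ, measureReal_restrict_apply, univ_inter,
    Real.volume_real_Ioc, smul_eq_mul, mul_one]
  -- It remains to see that the alternating sum of four minima equals max(min b d - max a c, 0).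
  grind

/-! ### Step functions: isometry and density -/

lemma StepFun.memLp_eval {t : ℝ} (s : StepFun t) {μ : Measure ℝ} [IsLocallyFiniteMeasure μ] :
    MemLp s.eval 2 μ := by
  unfold StepFun.eval
  refine memLp_finsetSum _ fun i _ => ?_
  exact memLp_indicator_const 2 measurableSet_Ioc _ (Or.inr measure_Ioc_lt_top.ne)

lemma StepFun.memLp_integral {t : ℝ} (s : StepFun t) (hW : IsBrownianReal W P) :
    MemLp (s.integral W) 2 P := by
  unfold StepFun.integral
  refine memLp_finsetSum _ fun i _ => ?_
  exact ((memLp_brownian hW _).sub (memLp_brownian hW _)).const_mul _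

/-- The Wiener isometry for step functions. -/
lemma StepFun.eLpNorm_integral_sub [IsProbabilityMeasure P] (hW : IsBrownianReal W P) {t t' : ℝ}
    (s : StepFun t) (s' : StepFun t') :
    eLpNorm (fun ω => s.integral W ω - s'.integral W ω) 2 P =
      eLpNorm (fun x => s.eval x - s'.eval x) 2 volume := by
  -- The difference is one step function over the disjoint union of the index sets, so both squared
  -- norms are the same quadratic form, in Gram matrices that agree entrywise.
  let c : Fin s.size ⊕ Fin s'.size → ℝ := Sum.elim s.coef fun i => -s'.coef i
  let l : Fin s.size ⊕ Fin s'.size → ℝ := Sum.elim s.left s'.left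
  let r : Fin s.size ⊕ Fin s'.size → ℝ := Sum.elim s.right s'.right
  have hl : ∀ i, 0 ≤ l i := by rintro (i | i) <;> simp [l, StepFun.left_nonneg]
  have hlr : ∀ i, l i ≤ r i := by rintro (i | i) <;> simp [l, r, StepFun.left_le_right]
  let f : Fin s.size ⊕ Fin s'.size → Ω → ℝ := fun i ω => W (r i).toNNReal ω - W (l i).toNNReal ω
  let g : Fin s.size ⊕ Fin s'.size → ℝ → ℝ := fun i => (Ioc (l i) (r i)).indicator fun _ => 1
  have hf : ∀ i, MemLp (f i) 2 P := fun i => (memLp_brownian hW _).sub (memLp_brownian hW _)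
  have hg : ∀ i, MemLp (g i) 2 volume := fun i =>
    memLp_indicator_const 2 measurableSet_Ioc _ (Or.inr measure_Ioc_lt_top.ne)
  have hfs : (fun ω => s.integral W ω - s'.integral W ω) = fun ω => ∑ i, c i * f i ω := by
    ext ω
    simp [StepFun.integral, c, f, l, r, Fintype.sum_sum_type, sub_eq_add_neg]
  have hgs : (fun x => s.eval x - s'.eval x) = fun x => ∑ i, c i * g i x := by
    ext x
    simp only [StepFun.eval, c, g, l, r, Fintype.sum_sum_type, Sum.elim_inl, Sum.elim_inr,
      sub_eq_add_neg, indicator_apply, mul_ite, mul_one, mul_zero, ← Finset.sum_neg_distrib]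
    congr 1
    exact Finset.sum_congr rfl fun i _ => by
      by_cases h : x ∈ Ioc (s'.left i) (s'.right i) <;> simp only [h, if_true, if_false, neg_zero]
  rw [hfs, hgs]
  refine eLpNorm_two_eq_of_integral_sq_eq (memLp_finsetSum _ fun i _ => (hf i).const_mul _)
    (memLp_finsetSum _ fun i _ => (hg i).const_mul _) ?_
  rw [integral_sum_mul_sum c hf, integral_sum_mul_sum c hg]
  refine Finset.sum_congr rfl fun i _ => Finset.sum_congr rfl fun j _ => ?_
  rw [integral_increment_mul_increment hW (hl i) (hlr i) (hl j) (hlr j)]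

/-- Norms over (0,t] may thus be computed on all of ℝ, where step functions with different horizons
can be compared. -/
lemma StepFun.indicator_eval {t : ℝ} (s : StepFun t) : (Ioc 0 t).indicator s.eval = s.eval := by
  refine indicator_eq_self.2 fun x hx => ?_
  obtain ⟨i, -, hi⟩ := Finset.exists_ne_zero_of_sum_ne_zero hx
  have := mem_of_indicator_ne_zero hi
  exact ⟨(s.left_nonneg i).trans_lt this.1, this.2.trans (s.right_le i)⟩

/-- The zero step function. -/
def StepFun.zero (t : ℝ) : StepFun t where
  size := 0
  coef := Fin.elim0
  left := Fin.elim0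
  right := Fin.elim0
  left_nonneg i := i.elim0
  left_le_right i := i.elim0
  right_le i := i.elim0

/-- The step function on `(0, t]` that interpolates `g` at the right endpoints of the uniform
partition into `N` intervals. -/
def StepFun.interpolate (g : ℝ → ℝ) {t : ℝ} (ht : 0 ≤ t) {N : ℕ} (hN : 0 < N) : StepFun t where
  size := N
  coef i := g (t * (i + 1) / N)
  left i := t * i / N
  right i := t * (i + 1) / N
  left_nonneg i := by positivity
  left_le_right i := by gcongr; linarith
  right_le i := by
    have hN' : (0 : ℝ) < N := by exact_mod_cast hN
    have : ((i : ℕ) : ℝ) + 1 ≤ N := by exact_mod_cast i.2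
    rw [div_le_iff₀ hN']
    gcongr

lemma StepFun.exists_eval_interpolate (g : ℝ → ℝ) {t : ℝ} (ht : 0 < t) {N : ℕ} (hN : 0 < N)
    {x : ℝ} (hx : x ∈ Ioc 0 t) :
    ∃ y, (StepFun.interpolate g ht.le hN).eval x = g y ∧ |y - x| ≤ t / N := by
  have hN' : (0 : ℝ) < N := by exact_mod_cast hN
  -- The cells are closed on the right, so the ceiling locates x in (t(j-1)/N, tj/N], which is the
  -- cell of index j - 1.
  set j := ⌈x * N / t⌉₊ with hj
  have hj0 : 0 < j := Nat.ceil_pos.2 (by have := hx.1; positivity)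
  have hjN : j ≤ N := by
    refine Nat.ceil_le.2 ?_
    rw [div_le_iff₀ ht, mul_comm]
    exact mul_le_mul_of_nonneg_left hx.2 hN'.le
  have h1 : x * N / t ≤ j := Nat.le_ceil _
  have h2 : (j : ℝ) < x * N / t + 1 := Nat.ceil_lt_add_one (by have := hx.1; positivity)
  rw [div_le_iff₀ ht] at h1
  have h2' : ((j : ℝ) - 1) * t < x * N := by rw [← lt_div_iff₀ ht]; linarith
  have hcast : ((j - 1 : ℕ) : ℝ) = j - 1 := by rw [Nat.cast_sub hj0]; simp
  refine ⟨t * j / N, ?_, ?_⟩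
  · unfold StepFun.eval
    rw [Finset.sum_eq_single (⟨j - 1, by simp [StepFun.interpolate]; omega⟩ :
      Fin (StepFun.interpolate g ht.le hN).size)]
    · rw [indicator_of_mem]
      · simp only [StepFun.interpolate, hcast, sub_add_cancel]
      · simp only [StepFun.interpolate, hcast, sub_add_cancel, mem_Ioc]
        rw [div_lt_iff₀ hN', le_div_iff₀ hN']
        constructor <;> linarith
    · intro i _ hi
      refine indicator_of_notMem (fun hmem => hi ?_) _
      simp only [StepFun.interpolate, mem_Ioc] at hmem
      rw [div_lt_iff₀ hN', le_div_iff₀ hN'] at hmem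
      have e1 : (i : ℝ) < j := by
        by_contra hcon
        push Not at hcon
        nlinarith [hmem.1]
      have e2 : (j : ℝ) - 1 < i + 1 := by
        by_contra hcon
        push Not at hcon
        nlinarith [hmem.2]
      have e1' : (i : ℕ) < j := by exact_mod_cast e1
      have e2' : j < (i : ℕ) + 2 := by
        have : (j : ℝ) < ((i : ℕ) + 2 : ℕ) := by push_cast; linarith
        exact_mod_cast this
      ext
      simp only
      omega
    · simp
  · have e : t * j / N - x = (t * j - x * N) / N := by field_simp
    rw [e, abs_of_nonneg (div_nonneg (by linarith) hN'.le)]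
    gcongr
    linarith

/-- Approximate k in L² by a compactly supported continuous g, then g uniformly by a fine
interpolation; each error is at most ε/2. -/
lemma StepFun.exists_eLpNorm_sub_le {t : ℝ} {k : ℝ → ℝ}
    (hk : MemLp k 2 (volume.restrict (Ioc 0 t))) {ε : ℝ≥0∞} (hε : ε ≠ 0) :
    ∃ s : StepFun t, eLpNorm (fun x => s.eval x - k x) 2 (volume.restrict (Ioc 0 t)) ≤ ε := by
  rcases le_or_gt t 0 with ht | ht
  · refine ⟨StepFun.zero t, ?_⟩
    simp [Ioc_eq_empty_of_le ht]
  have hε2 : ε / 2 ≠ 0 := by simpa using hε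
  obtain ⟨g, hgc, hgε, hg, hgm⟩ := hk.exists_hasCompactSupport_eLpNorm_sub_le (by simp) hε2
  have hfin : (volume.restrict (Ioc 0 t) univ) ^ (2 : ℝ≥0∞).toReal⁻¹ ≠ ∞ := by
    refine (ENNReal.rpow_lt_top_of_nonneg (by simp) ?_).ne
    simp
  -- On the finite measure space (0,t], a uniform error η costs at most η times a finite constant in
  -- L².
  obtain ⟨η, hη, hηε⟩ := ENNReal.exists_nnreal_pos_mul_lt hfin hε2
  obtain ⟨δ, hδ, hδg⟩ := Metric.uniformContinuous_iff.1
    (hgc.uniformContinuous_of_continuous hg) η hη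
  obtain ⟨N, hN⟩ := exists_nat_gt (t / δ)
  have hN0 : (0 : ℝ) < N := lt_trans (by positivity) hN
  have hNn : 0 < N := by exact_mod_cast hN0
  refine ⟨StepFun.interpolate g ht.le hNn, ?_⟩
  set s := StepFun.interpolate g ht.le hNn
  have hsg : eLpNorm (s.eval - g) 2 (volume.restrict (Ioc 0 t)) ≤ ε / 2 := by
    refine (eLpNorm_le_of_ae_bound (C := η) ?_).trans ?_
    · filter_upwards [self_mem_ae_restrict measurableSet_Ioc] with x hx
      obtain ⟨y, hy, hyx⟩ := StepFun.exists_eval_interpolate g ht hNn hx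
      rw [Pi.sub_apply, hy, ← dist_eq_norm]
      refine (hδg ?_).le
      rw [Real.dist_eq]
      refine hyx.trans_lt ?_
      rw [div_lt_iff₀ hN0]
      rwa [div_lt_iff₀ hδ, mul_comm] at hN
    · rw [ENNReal.ofReal_coe_nnreal, mul_comm]
      exact hηε.le
  calc eLpNorm (fun x => s.eval x - k x) 2 (volume.restrict (Ioc 0 t))
      = eLpNorm ((s.eval - g) + (g - k)) 2 (volume.restrict (Ioc 0 t)) := by
        congr 1; ext x; simp
    _ ≤ eLpNorm (s.eval - g) 2 (volume.restrict (Ioc 0 t)) +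
        eLpNorm (g - k) 2 (volume.restrict (Ioc 0 t)) :=
        eLpNorm_add_le (s.memLp_eval.sub hgm).1 (hgm.sub hk).1 (by norm_num)
    _ ≤ ε / 2 + ε / 2 := by
        gcongr
        rwa [eLpNorm_sub_comm]
    _ = ε := ENNReal.add_halves ε

lemma StepFun.exists_tendsto {t : ℝ} {k : ℝ → ℝ} (hk : MemLp k 2 (volume.restrict (Ioc 0 t))) :
    ∃ s : ℕ → StepFun t, Tendsto (fun m =>
      eLpNorm (fun x => (s m).eval x - k x) 2 (volume.restrict (Ioc 0 t))) atTop (𝓝 0) := by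
  choose s hs using fun m : ℕ => StepFun.exists_eLpNorm_sub_le hk
    (ε := ((m : ℝ≥0∞))⁻¹) (by simp)
  exact ⟨s, tendsto_of_tendsto_of_tendsto_of_le_of_le tendsto_const_nhds
    ENNReal.tendsto_inv_nat_nhds_zero (fun _ => zero_le) hs⟩

/-! ### Existence and isometry of the Wiener integral -/

/-- Every `k ∈ L²(0,t)` has a Wiener integral. -/
lemma exists_isWienerIntegral [IsProbabilityMeasure P] (hW : IsBrownianReal W P) {t : ℝ}
    {k : ℝ → ℝ} (hk : MemLp k 2 (volume.restrict (Ioc 0 t))) :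
    ∃ X : Ω → ℝ, IsWienerIntegral P W t k X := by
  obtain ⟨s, hs⟩ := StepFun.exists_tendsto hk
  have he : ∀ m, MemLp (s m).eval 2 (volume.restrict (Ioc 0 t)) := fun m => (s m).memLp_eval
  have hi : ∀ m, MemLp ((s m).integral W) 2 P := fun m => (s m).memLp_integral hW
  have hlim := (Lp.tendsto_Lp_iff_tendsto_eLpNorm'' _ he k hk).2 hs
  -- The isometry makes the elementary integrals Cauchy in L²(P), because the step functions
  -- converge in L²(0,t).
  have hdist : ∀ m n, dist ((hi m).toLp _) ((hi n).toLp _) =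
      dist ((he m).toLp _) ((he n).toLp _) := fun m n => by
    rw [dist_eq_norm, dist_eq_norm, ← MemLp.toLp_sub, ← MemLp.toLp_sub, Lp.norm_toLp, Lp.norm_toLp]
    congr 1
    refine (StepFun.eLpNorm_integral_sub hW (s m) (s n)).trans ?_
    rw [← eLpNorm_indicator_eq_eLpNorm_restrict measurableSet_Ioc, indicator_sub',
      StepFun.indicator_eval, StepFun.indicator_eval]
    rfl
  have hcau : CauchySeq fun m => (hi m).toLp _ := by
    have := hlim.cauchySeq
    rw [Metric.cauchySeq_iff] at this ⊢
    simpa only [hdist] using this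
  obtain ⟨X, hX⟩ := cauchySeq_tendsto_of_complete hcau
  refine ⟨X, hk, Lp.memLp X, s, hs, ?_⟩
  rw [← Lp.toLp_coeFn X (Lp.memLp X), Lp.tendsto_Lp_iff_tendsto_eLpNorm''] at hX
  exact hX

/-- The Wiener isometry. -/
lemma IsWienerIntegral.eLpNorm_sub [IsProbabilityMeasure P] (hW : IsBrownianReal W P) {t t' : ℝ}
    {k k' : ℝ → ℝ} {X X' : Ω → ℝ} (h : IsWienerIntegral P W t k X)
    (h' : IsWienerIntegral P W t' k' X') :
    eLpNorm (fun ω => X ω - X' ω) 2 P =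
      eLpNorm (fun x => (Ioc 0 t).indicator k x - (Ioc 0 t').indicator k' x) 2 volume := by
  obtain ⟨hk, hX, s, hsk, hsX⟩ := h
  obtain ⟨hk', hX', s', hsk', hsX'⟩ := h'
  have hind : ∀ {t : ℝ} {k : ℝ → ℝ} (s : StepFun t),
      eLpNorm (fun x => s.eval x - k x) 2 (volume.restrict (Ioc 0 t)) =
      eLpNorm (fun x => s.eval x - (Ioc 0 t).indicator k x) 2 volume := fun {t k} s => by
    rw [← eLpNorm_indicator_eq_eLpNorm_restrict measurableSet_Ioc]
    congr 1
    nth_rw 2 [← s.indicator_eval]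
    exact indicator_sub' _ _ _
  simp_rw [hind] at hsk hsk'
  have h1 := tendsto_eLpNorm_sub (fun m => (s m).memLp_integral hW)
    (fun m => (s' m).memLp_integral hW) hX hX' hsX hsX'
  have h2 := tendsto_eLpNorm_sub (fun m => (s m).memLp_eval) (fun m => (s' m).memLp_eval)
    ((memLp_indicator_iff_restrict measurableSet_Ioc).2 hk)
    ((memLp_indicator_iff_restrict measurableSet_Ioc).2 hk') hsk hsk'
  simp_rw [StepFun.eLpNorm_integral_sub hW] at h1
  exact tendsto_nhds_unique h1 h2

lemma IsWienerIntegral.eLpNorm_eq [IsProbabilityMeasure P] (hW : IsBrownianReal W P) {t : ℝ}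
    {k : ℝ → ℝ} {X : Ω → ℝ} (h : IsWienerIntegral P W t k X) :
    eLpNorm X 2 P = eLpNorm k 2 (volume.restrict (Ioc 0 t)) := by
  have h0 : IsWienerIntegral P W t (fun _ => 0) (fun _ => 0) := by
    refine ⟨MemLp.zero, MemLp.zero, fun _ => StepFun.zero t, ?_, ?_⟩
    · simp [StepFun.eval, StepFun.zero]
    · simp [StepFun.integral, StepFun.zero]
  have := h.eLpNorm_sub hW h0
  simp only [sub_zero, indicator_zero] at this
  rw [this, ← eLpNorm_indicator_eq_eLpNorm_restrict measurableSet_Ioc]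

lemma IsWienerIntegral.congr {t : ℝ} {k : ℝ → ℝ} {X Y : Ω → ℝ} (h : IsWienerIntegral P W t k X)
    (hXY : X =ᵐ[P] Y) : IsWienerIntegral P W t k Y := by
  obtain ⟨hk, hX, s, hsk, hsX⟩ := h
  refine ⟨hk, hX.ae_eq hXY, s, hsk, hsX.congr fun m => eLpNorm_congr_ae ?_⟩
  filter_upwards [hXY] with ω hω
  rw [hω]

end

section

/-! ### Jointly measurable versions -/

/-- A process that is uniformly continuous in mean square on `[0,T]` has a jointly measurable
version. -/
lemma exists_measurable_version {Ω : Type*} [MeasurableSpace Ω] {P : Measure Ω}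
    [IsProbabilityMeasure P] {T : ℝ} {X : ℝ → Ω → ℝ} (hX : ∀ t ∈ Icc 0 T, MemLp (X t) 2 P)
    (hcont : ∀ ε : ℝ≥0∞, ε ≠ 0 → ∃ δ > 0, ∀ t ∈ Icc 0 T, ∀ s ∈ Icc 0 T, |t - s| < δ →
      eLpNorm (fun ω => X t ω - X s ω) 2 P ≤ ε) :
    ∃ Y : ℝ → Ω → ℝ, Measurable (fun z : ℝ × Ω => Y z.1 z.2) ∧
      ∀ t ∈ Icc 0 T, X t =ᵐ[P] Y t := by
  classical
  choose δ hδ0 hδ using fun m : ℕ => hcont ((2 : ℝ≥0∞)⁻¹ ^ m) (by simp)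
  let R : ℝ → Ω → ℝ := fun s => if h : s ∈ Icc 0 T then (hX s h).1.mk (X s) else fun _ => 0
  have hRm : ∀ s, Measurable (R s) := fun s => by
    by_cases h : s ∈ Icc 0 T
    · simp only [R, dif_pos h]
      exact (hX s h).1.stronglyMeasurable_mk.measurable
    · simp only [R, dif_neg h]
      exact measurable_const
  have hRX : ∀ s ∈ Icc 0 T, R s =ᵐ[P] X s := fun s h => by
    simp only [R, dif_pos h]
    exact (hX s h).1.ae_eq_mk.symm
  -- Time is frozen at the grid point to its left, of mesh δ m / 2. This point stays in [0,T], and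
  -- since there are countably many, joint measurability follows.
  let grid : ℕ → ℝ → ℕ := fun m t => ⌊t / (δ m / 2)⌋₊
  let Ym : ℕ → ℝ × Ω → ℝ := fun m z => R (grid m z.1 * (δ m / 2)) z.2
  have hYm : ∀ m, Measurable (Ym m) := fun m => by
    have h1 : Measurable fun z : ℕ × Ω => R (z.1 * (δ m / 2)) z.2 :=
      measurable_from_prod_countable_right fun n => hRm (n * (δ m / 2))
    have h2 : Measurable fun z : ℝ × Ω => (grid m z.1, z.2) := by
      have : Measurable (grid m) := Nat.measurable_floor.comp (measurable_id.div_const _)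
      fun_prop
    exact h1.comp h2
  refine ⟨fun t ω => limUnder atTop fun m => Ym m (t, ω),
    (StronglyMeasurable.limUnder (l := atTop) fun m => (hYm m).stronglyMeasurable).measurable,
    fun t ht => ?_⟩
  have hbound : ∀ m, ∫⁻ ω, ‖Ym m (t, ω) - X t ω‖ₑ ∂P ≤ (2 : ℝ≥0∞)⁻¹ ^ m := fun m => by
    have hδ2 : 0 < δ m / 2 := half_pos (hδ0 m)
    set s := (grid m t : ℝ) * (δ m / 2) with hs
    have hst : s ≤ t := by
      rw [hs, ← le_div_iff₀ hδ2]
      exact Nat.floor_le (div_nonneg ht.1 hδ2.le)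
    have hts : t < s + δ m / 2 := by
      have : t / (δ m / 2) < grid m t + 1 := Nat.lt_floor_add_one _
      rw [div_lt_iff₀ hδ2] at this
      linarith
    have hsI : s ∈ Icc 0 T := ⟨by positivity, hst.trans ht.2⟩
    have hXs : eLpNorm (fun ω => X s ω - X t ω) 2 P ≤ (2 : ℝ≥0∞)⁻¹ ^ m :=
      hδ m s hsI t ht (by rw [abs_lt]; constructor <;> linarith [hδ0 m])
    have h1 : eLpNorm (fun ω => X s ω - X t ω) 1 P ≤ (2 : ℝ≥0∞)⁻¹ ^ m :=
      (eLpNorm_le_eLpNorm_of_exponent_le (by norm_num)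
        ((hX s hsI).1.sub (hX t ht).1)).trans hXs
    rw [eLpNorm_one_eq_lintegral_enorm] at h1
    refine le_trans (le_of_eq (lintegral_congr_ae ?_)) h1
    filter_upwards [hRX s hsI] with ω hω
    change ‖R s ω - X t ω‖ₑ = _
    rw [hω]
  have hmeas : ∀ m, AEMeasurable (fun ω => ‖Ym m (t, ω) - X t ω‖ₑ) P := fun m =>
    (((hYm m).comp measurable_prodMk_left).aemeasurable.sub (hX t ht).1.aemeasurable).enorm
  -- The L¹ errors are at most 2^(-m), so at a fixed time the errors are almost surely summable,
  -- hence tend to 0.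
  have hsum : ∫⁻ ω, ∑' m, ‖Ym m (t, ω) - X t ω‖ₑ ∂P ≠ ∞ := by
    rw [lintegral_tsum hmeas]
    refine ne_top_of_le_ne_top ?_ (ENNReal.tsum_le_tsum hbound)
    rw [ENNReal.tsum_geometric, ENNReal.one_sub_inv_two, inv_inv]
    simp
  filter_upwards [ae_lt_top' (AEMeasurable.tsum hmeas) hsum] with ω hω
  have h0 := ENNReal.tendsto_atTop_zero_of_tsum_ne_top hω.ne
  refine (Tendsto.limUnder_eq ?_).symm
  rw [tendsto_iff_edist_tendsto_0]
  simpa only [edist_eq_enorm_sub] using h0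

/-! ### Translations in `L²(ℝ)` -/

lemma exists_eLpNorm_translate_sub_le {K : ℝ → ℝ} (hK : MemLp K 2 volume) {ε : ℝ≥0∞}
    (hε : ε ≠ 0) :
    ∃ δ > 0, ∀ y : ℝ, |y| < δ → eLpNorm (fun x => K (x + y) - K x) 2 volume ≤ ε := by
  let g : ℝ → C(ℝ, ℝ) := fun y => ⟨fun x => x + y, by fun_prop⟩
  have hg : Continuous g :=
    ContinuousMap.continuous_of_continuous_uncurry _ (by
      change Continuous fun p : ℝ × ℝ => p.2 + p.1
      fun_prop)
  have hgm : ∀ y, MeasurePreserving (g y) volume volume := fun y =>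
    measurePreserving_add_right volume y
  have hc : Continuous fun y => Lp.compMeasurePreserving (g y) (hgm y) (hK.toLp K) :=
    continuous_const.compMeasurePreservingLp hg hgm (by simp)
  have ht := (Lp.tendsto_Lp_iff_tendsto_eLpNorm'' (fun y x => K (x + y))
    (fun y => hK.comp_measurePreserving (hgm y)) K hK (fi := 𝓝 0)).1 (by
      have := hc.tendsto 0
      simp_rw [Lp.toLp_compMeasurePreserving] at this
      have e : hK.toLp K = (hK.comp_measurePreserving (hgm 0)).toLp (K ∘ g 0) :=
        MemLp.toLp_congr _ _ (ae_of_all _ fun x => by simp [g])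
      rw [e]
      exact this)
  obtain ⟨δ, hδ, h⟩ := Metric.eventually_nhds_iff.1
    (ht.eventually (ge_mem_nhds (pos_iff_ne_zero.2 hε)))
  exact ⟨δ, hδ, fun y hy => h (by simpa using hy)⟩

lemma indicator_comp_sub_left (k : ℝ → ℝ) (t x : ℝ) :
    (Ioc 0 t).indicator (fun τ => k (t - τ)) x = (Ico 0 t).indicator k (t - x) := by
  by_cases h : x ∈ Ioc 0 t
  · rw [indicator_of_mem h, indicator_of_mem]
    exact ⟨by linarith [h.2], by linarith [h.1]⟩
  · rw [indicator_of_notMem h, indicator_of_notMem]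
    exact fun h' => h ⟨by linarith [h'.2], by linarith [h'.1]⟩

lemma eLpNorm_comp_sub_left (k : ℝ → ℝ) (hk : AEStronglyMeasurable k) (t : ℝ) :
    eLpNorm (fun τ => k (t - τ)) 2 (volume.restrict (Ioc 0 t)) =
      eLpNorm k 2 (volume.restrict (Ioc 0 t)) := by
  rw [← eLpNorm_indicator_eq_eLpNorm_restrict measurableSet_Ioc]
  have h := eLpNorm_comp_measurePreserving (p := 2) (hk.indicator (measurableSet_Ico (a := 0) (b := t)))
    (Measure.measurePreserving_sub_left volume t)
  rw [show (Ioc 0 t).indicator (fun τ => k (t - τ)) = (Ico 0 t).indicator k ∘ (fun x => t - x) from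
    funext (indicator_comp_sub_left k t), h,
    eLpNorm_indicator_eq_eLpNorm_restrict measurableSet_Ico, restrict_Ico_eq_restrict_Ioc]

/-- With K the kernel cut off to [0,T), the two integrands are K(t - x) and K(s - x) restricted to x
> 0. After reflection their difference is that of K and its translate by t - s. -/
lemma exists_eLpNorm_convolutionKernel_sub_le {k : ℝ → ℝ} {T : ℝ}
    (hk : MemLp ((Ico 0 T).indicator k) 2 volume) {ε : ℝ≥0∞} (hε : ε ≠ 0) :
    ∃ δ > 0, ∀ t ∈ Icc 0 T, ∀ s ∈ Icc 0 T, |t - s| < δ →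
      eLpNorm (fun x => (Ioc 0 t).indicator (fun τ => k (t - τ)) x -
        (Ioc 0 s).indicator (fun τ => k (s - τ)) x) 2 volume ≤ ε := by
  obtain ⟨δ, hδ, h⟩ := exists_eLpNorm_translate_sub_le hk hε
  refine ⟨δ, hδ, fun t ht s hs hts => ?_⟩
  set K := (Ico 0 T).indicator k with hK
  have hrep : ∀ t ∈ Icc 0 T, ∀ x, (Ioc 0 t).indicator (fun τ => k (t - τ)) x =
      (Ioi 0).indicator (fun x => K (t - x)) x := fun t ht x => by
    rw [indicator_comp_sub_left]
    simp only [hK, indicator_apply, mem_Ico, mem_Ioi]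
    have := ht.2
    split_ifs <;> first | rfl | (exfalso; grind)
  have hcomp : (fun x => K (t - x) - K (s - x)) =
      (fun y => K (y + (t - s)) - K y) ∘ fun x => s - x := by
    ext x
    simp only [Function.comp]
    congr 2
    ring
  have hmeas : AEStronglyMeasurable (fun y => K (y + (t - s)) - K y) volume :=
    (hk.1.comp_measurePreserving (measurePreserving_add_right volume (t - s))).sub hk.1
  calc _ ≤ eLpNorm (fun x => K (t - x) - K (s - x)) 2 volume := by
        refine eLpNorm_mono fun x => ?_
        rw [hrep t ht, hrep s hs]
        by_cases hx : x ∈ Ioi (0 : ℝ)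
        · simp [indicator_of_mem hx]
        · simp [indicator_of_notMem hx]
    _ = eLpNorm (fun y => K (y + (t - s)) - K y) 2 volume := by
        rw [hcomp]
        exact eLpNorm_comp_measurePreserving hmeas (Measure.measurePreserving_sub_left volume s)
    _ ≤ ε := h _ hts

/-! ### Bounds for the kernel -/

/-- The pointwise bound squares to s^(2α-2)/Γ(α)², integrable at 0 because α > 1/2. -/
lemma lintegral_mlKernel_sq_le {α lam : ℝ} (hα : α ∈ Ioo (1 / 2 : ℝ) 1) (hlam : 0 < lam) {t : ℝ}
    (ht : 0 ≤ t) :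
    ∫⁻ s in Ioc 0 t, ‖mlKernel α lam s‖ₑ ^ 2 ≤
      ENNReal.ofReal (t ^ (2 * α - 1) / ((2 * α - 1) * Real.Gamma α ^ 2)) := by
  have hα0 : 0 < α := by linarith [hα.1]
  have hG := Real.Gamma_pos_of_pos hα0
  have h_int : IntegrableOn (fun s : ℝ => s ^ (2 * α - 2) / Real.Gamma α ^ 2) (Ioc 0 t) :=
    ((intervalIntegrable_iff_integrableOn_Ioc_of_le ht).1
      (intervalIntegral.intervalIntegrable_rpow' (by linarith [hα.1]))).div_const _
  calc ∫⁻ s in Ioc 0 t, ‖mlKernel α lam s‖ₑ ^ 2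
      ≤ ∫⁻ s in Ioc 0 t, ENNReal.ofReal (s ^ (2 * α - 2) / Real.Gamma α ^ 2) := by
        refine setLIntegral_mono' measurableSet_Ioc fun s hs => ?_
        have h1 := mlKernel_pos hα0 hα.2 hlam hs.1
        have h2 := mlKernel_le hα0 hα.2 hlam hs.1
        rw [Real.enorm_of_nonneg h1.le, ← ENNReal.ofReal_pow h1.le]
        refine ENNReal.ofReal_le_ofReal ((pow_le_pow_left₀ h1.le h2 2).trans (le_of_eq ?_))
        rw [div_pow, ← Real.rpow_natCast (s ^ (α - 1)) 2, ← Real.rpow_mul hs.1.le]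
        congr 2
        push_cast
        ring
    _ = ENNReal.ofReal (∫ s in Ioc 0 t, s ^ (2 * α - 2) / Real.Gamma α ^ 2) := by
        rw [ofReal_integral_eq_lintegral_ofReal h_int]
        filter_upwards [self_mem_ae_restrict measurableSet_Ioc] with s hs
        have := hs.1.le
        positivity
    _ = _ := by
        rw [integral_div, ← intervalIntegral.integral_of_le ht,
          integral_rpow (Or.inl (by linarith [hα.1])),
          show 2 * α - 2 + 1 = 2 * α - 1 by ring,
          Real.zero_rpow (by linarith [hα.1]), sub_zero, div_div]

lemma memLp_mlKernel {α lam : ℝ} (hα : α ∈ Ioo (1 / 2 : ℝ) 1) (hlam : 0 < lam) (t : ℝ) :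
    MemLp (mlKernel α lam) 2 (volume.restrict (Ioc 0 t)) := by
  have hα0 : 0 < α := by linarith [hα.1]
  refine ⟨(measurable_mlKernel hα0).aestronglyMeasurable, ?_⟩
  rcases lt_or_ge t 0 with ht | ht
  · simp [Ioc_eq_empty_of_le ht.le]
  · have h := lintegral_mlKernel_sq_le hα hlam ht
    rw [← eLpNorm_two_sq] at h
    by_contra htop
    rw [not_lt, top_le_iff] at htop
    rw [htop] at h
    simp at h

lemma lintegral_mlKernel_le {α lam : ℝ} (hα : 0 < α) (hα1 : α < 1) (hlam : 0 < lam) {t : ℝ}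
    (ht : 0 < t) : ∫⁻ s in Ioc 0 t, ‖mlKernel α lam s‖ₑ ≤ ENNReal.ofReal (1 / lam) := by
  have h_int := (intervalIntegrable_iff_integrableOn_Ioc_of_le ht.le).1
    (intervalIntegrable_mlKernel (lam := lam) hα ht)
  have hpos : ∀ s ∈ Ioc 0 t, 0 ≤ mlKernel α lam s := fun s hs => (mlKernel_pos hα hα1 hlam hs.1).le
  calc ∫⁻ s in Ioc 0 t, ‖mlKernel α lam s‖ₑ
      = ∫⁻ s in Ioc 0 t, ENNReal.ofReal (mlKernel α lam s) :=
        setLIntegral_congr_fun measurableSet_Ioc fun s hs => Real.enorm_of_nonneg (hpos s hs)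
    _ = ENNReal.ofReal (∫ s in Ioc 0 t, mlKernel α lam s) := by
        rw [ofReal_integral_eq_lintegral_ofReal h_int]
        filter_upwards [self_mem_ae_restrict measurableSet_Ioc] with s hs using hpos s hs
    _ ≤ _ := by
        rw [← intervalIntegral.integral_of_le ht.le]
        exact ENNReal.ofReal_le_ofReal (integral_mlKernel_le hα hα1 hlam ht)

variable {Ω : Type*} [MeasurableSpace Ω] {P : Measure Ω} [IsProbabilityMeasure P] {W : ℝ≥0 → Ω → ℝ}

/-- The stochastic convolution with the Mittag-Leffler kernel has a jointly measurable version. -/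
lemma exists_measurable_wienerConvolution (hW : IsBrownianReal W P) {α lam : ℝ}
    (hα : α ∈ Ioo (1 / 2 : ℝ) 1) (hlam : 0 < lam) (T : ℝ) :
    ∃ J : ℝ → Ω → ℝ, Measurable (fun z : ℝ × Ω => J z.1 z.2) ∧ ∀ t ∈ Icc 0 T,
      IsWienerIntegral P W t (fun τ => mlKernel α lam (t - τ)) (J t) := by
  have hα0 : 0 < α := by linarith [hα.1]
  have hkm := measurable_mlKernel (lam := lam) hα0
  have hk : ∀ t, MemLp (fun τ => mlKernel α lam (t - τ)) 2 (volume.restrict (Ioc 0 t)) := fun t =>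
    ⟨(hkm.comp (measurable_const.sub measurable_id)).aestronglyMeasurable, by
      rw [eLpNorm_comp_sub_left _ hkm.aestronglyMeasurable]
      exact (memLp_mlKernel hα hlam t).2⟩
  choose X hX using fun t => exists_isWienerIntegral hW (hk t)
  have hK : MemLp ((Ico 0 T).indicator (mlKernel α lam)) 2 volume := by
    rw [memLp_indicator_iff_restrict measurableSet_Ico, restrict_Ico_eq_restrict_Ioc]
    exact memLp_mlKernel hα hlam T
  -- By the isometry, the mean-square modulus of continuity of the process is the L² modulus of the
  -- kernels.
  obtain ⟨J, hJ, hXJ⟩ := exists_measurable_version (T := T) (X := X) (fun t _ => (hX t).2.1)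
    (fun ε hε => by
      obtain ⟨δ, hδ, h⟩ := exists_eLpNorm_convolutionKernel_sub_le hK hε
      refine ⟨δ, hδ, fun t ht s hs hts => ?_⟩
      rw [(hX t).eLpNorm_sub hW (hX s)]
      exact h t ht s hs hts)
  exact ⟨J, hJ, fun t ht => (hX t).congr (hXJ t ht)⟩

end

/-! ### Expansions in a Hilbert basis -/

section Hilbert

variable {E : Type*} [NormedAddCommGroup E] [InnerProductSpace ℝ E]

lemma inner_eq_of_hasSum_smul (b : HilbertBasis ℕ ℝ E) {c : ℕ → ℝ} {u : E}
    (h : HasSum (fun n => c n • b n) u) (n : ℕ) : inner ℝ u (b n) = c n := by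
  have h1 := h.mapL (innerSL ℝ (b n))
  simp only [innerSL_apply_apply, inner_smul_right] at h1
  have h2 : HasSum (fun m => c m * inner ℝ (b n) (b m)) (c n * inner ℝ (b n) (b n)) :=
    hasSum_single n fun m hm => by rw [b.orthonormal.2 hm.symm, mul_zero]
  rw [real_inner_comm, h1.unique h2, real_inner_self_eq_norm_sq, b.orthonormal.1]
  simp

lemma enorm_sq_eq_tsum_inner (b : HilbertBasis ℕ ℝ E) (u : E) :
    ‖u‖ₑ ^ 2 = ∑' n, ‖inner ℝ u (b n)‖ₑ ^ 2 := by
  have h := b.hasSum_inner_mul_inner u u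
  simp_rw [real_inner_comm u (b _)] at h
  rw [real_inner_self_eq_norm_sq] at h
  rw [← ofReal_norm, ← ENNReal.ofReal_pow (norm_nonneg u), ← h.tsum_eq,
    ENNReal.ofReal_tsum_of_nonneg (fun n => mul_self_nonneg _) h.summable]
  refine tsum_congr fun n => ?_
  rw [← Real.enorm_of_nonneg (mul_self_nonneg _), ← pow_two, enorm_pow]

lemma enorm_sq_eq_tsum_of_hasSum (b : HilbertBasis ℕ ℝ E) {c : ℕ → ℝ} {u : E}
    (h : HasSum (fun n => c n • b n) u) : ‖u‖ₑ ^ 2 = ∑' n, ‖c n‖ₑ ^ 2 := by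
  rw [enorm_sq_eq_tsum_inner b]
  exact tsum_congr fun n => by rw [inner_eq_of_hasSum_smul b h]

lemma exists_hasSum_smul (b : HilbertBasis ℕ ℝ E) {c : ℕ → ℝ}
    (h : ∑' n, ‖c n‖ₑ ^ 2 ≠ ∞) : ∃ u, HasSum (fun n => c n • b n) u := by
  have hc : Memℓp c 2 := by
    refine memℓp_gen ?_
    have := ENNReal.summable_toReal h
    simpa using this
  exact ⟨_, b.hasSum_repr_symm ⟨c, hc⟩⟩

end Hilbert

/-! ### Eigenvalues -/

section Eigen

variable {d : ℕ} {D : Set (Space d)} {A : DiffOp d}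

lemma DiffOp.IsEigensystem.pos {lam : ℕ → ℝ} {phi : HilbertBasis ℕ ℝ (L2 D)}
    (h : A.IsEigensystem D lam phi) (hA : A.IsSymmEllipticPosDef D) (n : ℕ) : 0 < lam n := by
  have := hA.posDef _ _ (h.eigen n) (phi.orthonormal.ne_zero n)
  rw [real_inner_smul_left, real_inner_self_eq_norm_sq, phi.orthonormal.1] at this
  simpa using this

/-- The lowest eigenvalue bounds the eigenvalues of every eigensystem. -/
lemma DiffOp.IsEigensystem.le {lam mu : ℕ → ℝ} {phi psi : HilbertBasis ℕ ℝ (L2 D)}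
    (h : A.IsEigensystem D lam phi) (h' : A.IsEigensystem D mu psi)
    (hA : A.IsSymmEllipticPosDef D) (n : ℕ) : lam 0 ≤ mu n := by
  -- Some φ_m is not orthogonal to ψ_n, as ψ_n ≠ 0 and φ is complete; symmetry of the operator then
  -- forces λ_m = μ_n.
  obtain ⟨m, hm⟩ : ∃ m, inner ℝ (phi m) (psi n) ≠ 0 := by
    by_contra hcon
    push Not at hcon
    have h1 := enorm_sq_eq_tsum_inner phi (psi n)
    simp_rw [real_inner_comm, hcon] at h1
    exact psi.orthonormal.ne_zero n (by simpa using h1)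
  have hs := hA.symm _ _ _ _ (h.eigen m) (h'.eigen n)
  rw [real_inner_smul_left, real_inner_smul_right] at hs
  rw [← mul_right_cancel₀ hm hs]
  exact h.mono (Nat.zero_le m)

end Eigen

/-! ### Deterministic convolution -/

/-- Cauchy–Schwarz for the splitting K H = K^(1/2) · (K H²)^(1/2). -/
lemma lintegral_mul_sq_le {X : Type*} [MeasurableSpace X] {μ : Measure X} {K H : X → ℝ≥0∞}
    (hK : AEMeasurable K μ) (hH : AEMeasurable H μ) :
    (∫⁻ x, K x * H x ∂μ) ^ 2 ≤ (∫⁻ x, K x ∂μ) * ∫⁻ x, K x * H x ^ 2 ∂μ := by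
  have h := ENNReal.lintegral_mul_norm_pow_le hK (hK.mul (hH.pow_const 2))
    (p := 1 / 2) (q := 1 / 2) (by norm_num) (by norm_num) (by norm_num)
  have hpt : ∀ x, K x ^ (1 / 2 : ℝ) * (K x * H x ^ 2) ^ (1 / 2 : ℝ) = K x * H x := fun x => by
    rw [ENNReal.mul_rpow_of_nonneg _ _ (by norm_num), ← mul_assoc,
      ← ENNReal.rpow_add_of_nonneg _ _ (by norm_num) (by norm_num), ← ENNReal.rpow_natCast,
      ← ENNReal.rpow_mul]
    norm_num
  have hsq : ∀ a : ℝ≥0∞, (a ^ (1 / 2 : ℝ)) ^ 2 = a := fun a => by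
    rw [← ENNReal.rpow_natCast, ← ENNReal.rpow_mul]
    norm_num
  simp only [Pi.mul_apply, hpt] at h
  calc (∫⁻ x, K x * H x ∂μ) ^ 2 ≤ _ := pow_le_pow_left' h 2
    _ = _ := by rw [mul_pow, hsq, hsq]

/-- Young's inequality for convolution with an integrable kernel. -/
lemma lintegral_convolution_sq_le {K H : ℝ → ℝ≥0∞} (hK : Measurable K) (hH : AEMeasurable H) :
    ∫⁻ t, (∫⁻ τ, K (t - τ) * H τ) ^ 2 ≤ (∫⁻ s, K s) ^ 2 * ∫⁻ τ, H τ ^ 2 := by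
  have hKt : ∀ t, Measurable fun τ => K (t - τ) := fun t =>
    hK.comp (measurable_const.sub measurable_id)
  -- Cauchy–Schwarz with weight K(t - τ), then Tonelli and translation invariance.
  calc ∫⁻ t, (∫⁻ τ, K (t - τ) * H τ) ^ 2
      ≤ ∫⁻ t, (∫⁻ s, K s) * ∫⁻ τ, K (t - τ) * H τ ^ 2 := by
        refine lintegral_mono fun t => ?_
        have := lintegral_mul_sq_le (μ := volume) (hKt t).aemeasurable hH
        rwa [lintegral_sub_left_eq_self K t] at this
    _ = (∫⁻ s, K s) * ∫⁻ τ, ∫⁻ t, K (t - τ) * H τ ^ 2 := by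
        have hm : AEMeasurable (Function.uncurry fun t τ : ℝ => K (t - τ) * H τ ^ 2)
            (volume.prod volume) :=
          (hK.comp (measurable_fst.sub measurable_snd)).aemeasurable.mul
            (hH.comp_snd.pow_const 2)
        have hm' : AEMeasurable fun t => ∫⁻ τ, K (t - τ) * H τ ^ 2 := hm.lintegral_prod_right'
        rw [lintegral_const_mul'' _ hm', lintegral_lintegral_swap hm]
    _ = _ := by
        have : ∀ τ, ∫⁻ t, K (t - τ) * H τ ^ 2 = (∫⁻ s, K s) * H τ ^ 2 := fun τ => by
          have hKτ : Measurable fun t => K (t - τ) :=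
            hK.comp (measurable_id.sub measurable_const)
          rw [lintegral_mul_const _ hKτ, lintegral_sub_right_eq_self K τ]
        simp_rw [this]
        rw [lintegral_const_mul'' _ (hH.pow_const 2), ← mul_assoc, pow_two]

/-- The convolution on `[0,T]` of the absolute values of `k` and `h`. -/
def absConv (k h : ℝ → ℝ) (T t : ℝ) : ℝ≥0∞ :=
  ∫⁻ τ, (Ico 0 T).indicator (fun s => ‖k s‖ₑ) (t - τ) * (Ioc 0 T).indicator (fun s => ‖h s‖ₑ) τ

section AbsConv

variable {k h : ℝ → ℝ} {T : ℝ}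

lemma aemeasurable_indicator_enorm (hh : AEMeasurable h (volume.restrict (Icc 0 T))) :
    AEMeasurable ((Ioc 0 T).indicator fun s => ‖h s‖ₑ) :=
  (aemeasurable_indicator_iff measurableSet_Ioc).2
    (hh.mono_measure (Measure.restrict_mono Ioc_subset_Icc_self le_rfl)).enorm

lemma aemeasurable_absConv (hk : Measurable k)
    (hh : AEMeasurable h (volume.restrict (Icc 0 T))) : AEMeasurable (absConv k h T) := by
  have hm : AEMeasurable (fun z : ℝ × ℝ => (Ico 0 T).indicator (fun s => ‖k s‖ₑ) (z.1 - z.2) *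
      (Ioc 0 T).indicator (fun s => ‖h s‖ₑ) z.2) (volume.prod volume) :=
    ((hk.enorm.indicator measurableSet_Ico).comp
      (measurable_fst.sub measurable_snd)).aemeasurable.mul
      (aemeasurable_indicator_enorm hh).comp_snd
  exact hm.lintegral_prod_right'

lemma enorm_integral_le_absConv {t : ℝ} (ht : t ∈ Icc 0 T) :
    ‖∫ τ in (0 : ℝ)..t, k (t - τ) * h τ‖ₑ ≤ absConv k h T t := by
  rw [intervalIntegral.integral_of_le ht.1]
  refine (enorm_integral_le_lintegral_enorm _).trans ?_
  rw [← lintegral_indicator measurableSet_Ioc]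
  refine lintegral_mono fun τ => ?_
  by_cases hτ : τ ∈ Ioc 0 t
  · have h1 : t - τ ∈ Ico 0 T := ⟨by linarith [hτ.2], by linarith [hτ.1, ht.2]⟩
    have h2 : τ ∈ Ioc 0 T := ⟨hτ.1, hτ.2.trans ht.2⟩
    rw [indicator_of_mem hτ, indicator_of_mem h1, indicator_of_mem h2, enorm_mul]
  · rw [indicator_of_notMem hτ]
    exact zero_le

lemma lintegral_absConv_sq_le (hk : Measurable k)
    (hh : AEMeasurable h (volume.restrict (Icc 0 T))) :
    ∫⁻ t in Icc 0 T, absConv k h T t ^ 2 ≤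
      (∫⁻ s in Ioc 0 T, ‖k s‖ₑ) ^ 2 * eLpNorm h 2 (volume.restrict (Icc 0 T)) ^ 2 := by
  refine (setLIntegral_le_lintegral _ _).trans ((lintegral_convolution_sq_le
    (hk.enorm.indicator measurableSet_Ico) (aemeasurable_indicator_enorm hh)).trans
    (le_of_eq ?_))
  rw [lintegral_indicator measurableSet_Ico, restrict_Ico_eq_restrict_Ioc, eLpNorm_two_sq,
    ← restrict_Ioc_eq_restrict_Icc, ← lintegral_indicator measurableSet_Ioc (fun τ => ‖h τ‖ₑ ^ 2)]
  congr 1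
  refine lintegral_congr fun τ => ?_
  by_cases hτ : τ ∈ Ioc 0 T
  · rw [indicator_of_mem hτ, indicator_of_mem hτ]
  · rw [indicator_of_notMem hτ, indicator_of_notMem hτ]
    simp

/-- Young's inequality only bounds the convolution in L² of time. This bound holds at every t, as
convergence of the series at each fixed time requires. -/
lemma absConv_le (hk : Measurable k) (t : ℝ) :
    absConv k h T t ≤ (∫⁻ s in Ioc 0 T, ‖k s‖ₑ) * eLpNorm h ∞ (volume.restrict (Icc 0 T)) := by
  have hae : ∀ᵐ τ : ℝ, (Ioc 0 T).indicator (fun s => ‖h s‖ₑ) τ ≤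
      eLpNorm h ∞ (volume.restrict (Icc 0 T)) := by
    rw [eLpNorm_exponent_top]
    filter_upwards [(ae_restrict_iff' measurableSet_Icc).1
      (ae_le_eLpNormEssSup (f := h) (μ := volume.restrict (Icc 0 T)))] with τ hτ
    by_cases hm : τ ∈ Ioc 0 T
    · rw [indicator_of_mem hm]
      exact hτ (Ioc_subset_Icc_self hm)
    · rw [indicator_of_notMem hm]
      exact zero_le
  have hKm : Measurable ((Ico 0 T).indicator fun s => ‖k s‖ₑ) :=
    hk.enorm.indicator measurableSet_Ico
  calc absConv k h T t
      ≤ ∫⁻ τ, (Ico 0 T).indicator (fun s => ‖k s‖ₑ) (t - τ) *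
          eLpNorm h ∞ (volume.restrict (Icc 0 T)) := by
        refine lintegral_mono_ae ?_
        filter_upwards [hae] with τ hτ
        gcongr
    _ = _ := by
        have hKt : Measurable fun τ => (Ico 0 T).indicator (fun s => ‖k s‖ₑ) (t - τ) :=
          hKm.comp (measurable_const.sub measurable_id)
        rw [lintegral_mul_const _ hKt, lintegral_sub_left_eq_self, lintegral_indicator measurableSet_Ico,
          restrict_Ico_eq_restrict_Ioc]

/-- The convolution integral is a measurable function of time, up to the choice of a measurable
version of `h`. -/
lemma exists_measurable_integral (hk : Measurable k)
    (hh : AEMeasurable h (volume.restrict (Icc 0 T))) :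
    ∃ F : ℝ → ℝ, Measurable F ∧ ∀ t ∈ Icc 0 T, F t = ∫ τ in (0 : ℝ)..t, k (t - τ) * h τ := by
  set g := hh.mk h with hg
  have hgm : Measurable g := hh.measurable_mk
  let G : ℝ → ℝ → ℝ := fun t τ => if 0 < τ ∧ τ ≤ t then k (t - τ) * g τ else 0
  have hG : Measurable (Function.uncurry G) := by
    refine Measurable.ite ?_ ?_ measurable_const
    · exact (measurableSet_lt measurable_const measurable_snd).inter
        (measurableSet_le measurable_snd measurable_fst)
    · exact (hk.comp (measurable_fst.sub measurable_snd)).mul (hgm.comp measurable_snd)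
  refine ⟨fun t => ∫ τ, G t τ, hG.stronglyMeasurable.integral_prod_right.measurable,
    fun t ht => ?_⟩
  rw [intervalIntegral.integral_of_le ht.1, ← integral_indicator measurableSet_Ioc]
  refine integral_congr_ae ?_
  filter_upwards [(ae_restrict_iff' measurableSet_Icc).1 hh.ae_eq_mk] with τ hτ
  by_cases hm : τ ∈ Ioc 0 t
  · rw [indicator_of_mem hm, hτ ⟨hm.1.le, hm.2.trans ht.2⟩]
    exact if_pos hm
  · rw [indicator_of_notMem hm]
    exact if_neg hm

end AbsConv

lemma enorm_add_sq_le (x y : ℝ) : ‖x + y‖ₑ ^ 2 ≤ 2 * ‖x‖ₑ ^ 2 + 2 * ‖y‖ₑ ^ 2 := by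
  have key : ∀ z : ℝ, ‖z‖ₑ ^ 2 = ENNReal.ofReal (z ^ 2) := fun z => by
    rw [← enorm_pow, Real.enorm_of_nonneg (sq_nonneg z)]
  rw [key, key, key, show (2 : ℝ≥0∞) = ENNReal.ofReal 2 by simp,
    ← ENNReal.ofReal_mul (by norm_num), ← ENNReal.ofReal_mul (by norm_num),
    ← ENNReal.ofReal_add (by positivity) (by positivity)]
  exact ENNReal.ofReal_le_ofReal (by nlinarith [sq_nonneg (x - y)])

/-! ### The mild solution -/

section Mild

variable {d : ℕ} {D : Set (Space d)} {α T : ℝ} {lam : ℕ → ℝ} {phi : HilbertBasis ℕ ℝ (L2 D)}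
  {f g : L2 D} {h : ℝ → ℝ} {Ω : Type*} [MeasurableSpace Ω] {P : Measure Ω}
  [IsProbabilityMeasure P] {W : ℝ≥0 → Ω → ℝ}

/-- A bound for the second moment of `∫₀ᵗ (t-τ)^{α-1} E_{α,α}(-λ (t-τ)^α) dW(τ)`, `t ≤ T`. -/
def wienerBound (α T : ℝ) : ℝ := T ^ (2 * α - 1) / ((2 * α - 1) * Real.Gamma α ^ 2)

lemma lintegral_wienerConvolution_sq_le (hW : IsBrownianReal W P) (hα : α ∈ Ioo (1 / 2 : ℝ) 1)
    {l : ℝ} (hl : 0 < l) {t : ℝ} (ht : t ∈ Icc 0 T) {X : Ω → ℝ}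
    (hX : IsWienerIntegral P W t (fun τ => mlKernel α l (t - τ)) X) :
    ∫⁻ ω, ‖X ω‖ₑ ^ 2 ∂P ≤ ENNReal.ofReal (wienerBound α T) := by
  have hα0 : 0 < α := by linarith [hα.1]
  have hα2 : 0 < 2 * α - 1 := by linarith [hα.1]
  rw [← eLpNorm_two_sq, hX.eLpNorm_eq hW,
    eLpNorm_comp_sub_left _ (measurable_mlKernel hα0).aestronglyMeasurable, eLpNorm_two_sq]
  refine (lintegral_mlKernel_sq_le hα hl ht.1).trans (ENNReal.ofReal_le_ofReal ?_)
  have h1 : t ^ (2 * α - 1) ≤ T ^ (2 * α - 1) := Real.rpow_le_rpow ht.1 ht.2 hα2.le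
  unfold wienerBound
  gcongr

/-- The bound at a fixed time that serves both halves of the theorem: its finiteness gives
convergence, its integral over [0,T] the estimate. The factors 2 come from (x + y)² ≤ 2x² + 2y². -/
lemma lintegral_tsum_coeff_sq_le (hW : IsBrownianReal W P) (hα : α ∈ Ioo (1 / 2 : ℝ) 1)
    (hlam : ∀ n, 0 < lam n) {t : ℝ} (ht : t ∈ Icc 0 T) {J : ℕ → Ω → ℝ}
    (hJ : ∀ n, IsWienerIntegral P W t (fun τ => mlKernel α (lam n) (t - τ)) (J n)) :
    ∫⁻ ω, ∑' n, ‖detCoeff α lam phi f h n t + inner ℝ g (phi n) * J n ω‖ₑ ^ 2 ∂P ≤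
      ∑' n, (2 * (‖inner ℝ f (phi n)‖ₑ ^ 2 * absConv (mlKernel α (lam n)) h T t ^ 2) +
        2 * (‖inner ℝ g (phi n)‖ₑ ^ 2 * ENNReal.ofReal (wienerBound α T))) := by
  have hJm : ∀ n, AEMeasurable (J n) P := fun n => (hJ n).2.1.1.aemeasurable
  rw [lintegral_tsum fun n => ((hJm n).const_mul _).const_add _ |>.enorm.pow_const 2]
  refine ENNReal.tsum_le_tsum fun n => ?_
  calc ∫⁻ ω, ‖detCoeff α lam phi f h n t + inner ℝ g (phi n) * J n ω‖ₑ ^ 2 ∂P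
      ≤ ∫⁻ ω, (2 * (‖inner ℝ f (phi n)‖ₑ ^ 2 * absConv (mlKernel α (lam n)) h T t ^ 2) +
          2 * (‖inner ℝ g (phi n)‖ₑ ^ 2 * ‖J n ω‖ₑ ^ 2)) ∂P := by
        refine lintegral_mono fun ω => (enorm_add_sq_le _ _).trans ?_
        rw [detCoeff, enorm_mul, enorm_mul, mul_pow, mul_pow]
        gcongr
        exact enorm_integral_le_absConv ht
    _ = 2 * (‖inner ℝ f (phi n)‖ₑ ^ 2 * absConv (mlKernel α (lam n)) h T t ^ 2) +
          2 * (‖inner ℝ g (phi n)‖ₑ ^ 2 * ∫⁻ ω, ‖J n ω‖ₑ ^ 2 ∂P) := by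
        rw [lintegral_add_left measurable_const, lintegral_const, measure_univ, mul_one,
          lintegral_const_mul' _ _ (by simp), lintegral_const_mul' _ _ (by simp)]
    _ ≤ _ := by
        gcongr
        exact lintegral_wienerConvolution_sq_le hW hα (hlam n) ht (hJ n)

lemma lintegral_enorm_mlKernel_le (hα : α ∈ Ioo (1 / 2 : ℝ) 1) (hT : 0 < T) {l0 l : ℝ}
    (hl0 : 0 < l0) (hl : l0 ≤ l) :
    ∫⁻ s in Ioc 0 T, ‖mlKernel α l s‖ₑ ≤ ENNReal.ofReal (1 / l0) :=
  (lintegral_mlKernel_le (by linarith [hα.1]) hα.2 (hl0.trans_le hl) hT).trans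
    (ENNReal.ofReal_le_ofReal (one_div_le_one_div_of_le hl0 hl))

lemma exists_isMildSolution (hW : IsBrownianReal W P) (hα : α ∈ Ioo (1 / 2 : ℝ) 1) (hT : 0 < T)
    {l0 : ℝ} (hl0 : 0 < l0) (hlam : ∀ n, l0 ≤ lam n)
    (hh : MemLp h ∞ (volume.restrict (Icc 0 T))) :
    ∃ u : ℝ → Ω → L2 D, IsMildSolution α lam phi T f g h P W u := by
  have hα0 : 0 < α := by linarith [hα.1]
  have hlam0 : ∀ n, 0 < lam n := fun n => hl0.trans_le (hlam n)
  choose J hJm hJ using fun n => exists_measurable_wienerConvolution hW hα (hlam0 n) T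
  choose F hFm hF using fun n => exists_measurable_integral (T := T)
    (measurable_mlKernel (lam := lam n) hα0) hh.1.aemeasurable
  -- F and J are versions measurable in time, so the partial sums, and their limit, are jointly
  -- measurable.
  let c : ℕ → ℝ × Ω → ℝ := fun n z =>
    inner ℝ f (phi n) * F n z.1 + inner ℝ g (phi n) * J n z.1 z.2
  have hc : ∀ n, Measurable (c n) := fun n =>
    (((hFm n).comp measurable_fst).const_mul _).add ((hJm n).const_mul _)
  let S : ℕ → ℝ × Ω → L2 D := fun N z => ∑ n ∈ Finset.range N, c n z • phi n
  have hS : ∀ N, StronglyMeasurable (S N) := fun N =>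
    Finset.stronglyMeasurable_fun_sum _ fun n _ => (hc n).stronglyMeasurable.smul_const _
  refine ⟨fun t ω => limUnder atTop fun N => S N (t, ω),
    (StronglyMeasurable.limUnder (l := atTop) hS).aestronglyMeasurable, J, hJ, fun t ht => ?_⟩
  have hceq : ∀ n ω, c n (t, ω) =
      detCoeff α lam phi f h n t + inner ℝ g (phi n) * J n t ω := fun n ω => by
    simp only [c, detCoeff, hF n t ht]
  have hfin : ∫⁻ ω, ∑' n, ‖c n (t, ω)‖ₑ ^ 2 ∂P ≠ ∞ := by
    simp_rw [hceq]
    refine ne_top_of_le_ne_top ?_ (lintegral_tsum_coeff_sq_le hW hα hlam0 ht fun n => hJ n t ht)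
    -- B bounds the drift convolutions uniformly in n because λ_n ≥ l0; what remains of the sums
    -- over n is ‖f‖² and ‖g‖².
    set B : ℝ≥0∞ := ENNReal.ofReal (1 / l0) * eLpNorm h ∞ (volume.restrict (Icc 0 T)) with hB
    have hBtop : B ≠ ∞ := ENNReal.mul_ne_top (by simp) hh.2.ne
    have hle : ∀ n, absConv (mlKernel α (lam n)) h T t ≤ B := fun n =>
      (absConv_le (measurable_mlKernel hα0) t).trans
        (mul_le_mul_left (lintegral_enorm_mlKernel_le hα hT hl0 (hlam n)) _)
    refine ne_top_of_le_ne_top ?_ (ENNReal.tsum_le_tsum fun n => add_le_add_left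
      (mul_le_mul_right (mul_le_mul_right (pow_le_pow_left' (hle n) 2) _) _) _)
    rw [ENNReal.tsum_add, ENNReal.tsum_mul_left, ENNReal.tsum_mul_left, ENNReal.tsum_mul_right,
      ENNReal.tsum_mul_right, ← enorm_sq_eq_tsum_inner, ← enorm_sq_eq_tsum_inner]
    finiteness
  have hm : Measurable fun ω => ∑' n, ‖c n (t, ω)‖ₑ ^ 2 :=
    Measurable.tsum fun n => ((hc n).comp measurable_prodMk_left).enorm.pow_const 2
  filter_upwards [ae_lt_top hm hfin] with ω hω
  obtain ⟨v, hv⟩ := exists_hasSum_smul phi hω.ne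
  have hlim : (limUnder atTop fun N => S N (t, ω)) = v := hv.tendsto_sum_nat.limUnder_eq
  simp only [hlim, ← hceq]
  exact hv

lemma IsMildSolution.expectedSqNorm_le (hW : IsBrownianReal W P) (hα : α ∈ Ioo (1 / 2 : ℝ) 1)
    (hT : 0 < T) {l0 : ℝ} (hl0 : 0 < l0) (hlam : ∀ n, l0 ≤ lam n)
    (hh : MemLp h ∞ (volume.restrict (Icc 0 T))) {u : ℝ → Ω → L2 D}
    (hu : IsMildSolution α lam phi T f g h P W u) :
    expectedSqNorm T P u ≤
      2 * (‖f‖ₑ ^ 2 * (ENNReal.ofReal (1 / l0) ^ 2 *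
        eLpNorm h 2 (volume.restrict (Icc 0 T)) ^ 2)) +
      2 * (‖g‖ₑ ^ 2 * ENNReal.ofReal (wienerBound α T)) * ENNReal.ofReal T := by
  have hα0 : 0 < α := by linarith [hα.1]
  have hlam0 : ∀ n, 0 < lam n := fun n => hl0.trans_le (hlam n)
  obtain ⟨J, hJ, hsum⟩ := hu.expansion
  have hsq : ∀ ω, eLpNorm (fun t => u t ω) 2 (volume.restrict (Icc 0 T)) ^ 2 =
      ∫⁻ t in Icc 0 T, ‖u t ω‖ₑ ^ 2 := fun ω => by
    have := eLpNorm_nnreal_pow_eq_lintegral (f := fun t => u t ω) (p := 2)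
      (μ := volume.restrict (Icc 0 T)) (by norm_num)
    simpa using this
  have hm : AEMeasurable (Function.uncurry fun t ω => ‖u t ω‖ₑ ^ 2)
      ((volume.restrict (Icc 0 T)).prod P) := hu.measurable.enorm.pow_const 2
  have hV : ∀ n, AEMeasurable (absConv (mlKernel α (lam n)) h T) := fun n =>
    aemeasurable_absConv (measurable_mlKernel hα0) hh.1.aemeasurable
  unfold expectedSqNorm
  simp_rw [hsq]
  -- Tonelli, by joint measurability of u: the almost sure expansion is available only at each fixed
  -- time, so the integral over Ω must be the inner one.
  rw [← lintegral_lintegral_swap hm]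
  calc ∫⁻ t in Icc 0 T, ∫⁻ ω, ‖u t ω‖ₑ ^ 2 ∂P
      ≤ ∫⁻ t in Icc 0 T, ∑' n,
        (2 * (‖inner ℝ f (phi n)‖ₑ ^ 2 * absConv (mlKernel α (lam n)) h T t ^ 2) +
        2 * (‖inner ℝ g (phi n)‖ₑ ^ 2 * ENNReal.ofReal (wienerBound α T))) := by
        refine setLIntegral_mono' measurableSet_Icc fun t ht => ?_
        refine le_trans (le_of_eq (lintegral_congr_ae ?_))
          (lintegral_tsum_coeff_sq_le hW hα hlam0 ht fun n => hJ n t ht)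
        filter_upwards [hsum t ht] with ω hω
        exact enorm_sq_eq_tsum_of_hasSum phi hω
    _ = ∑' n, (2 * (‖inner ℝ f (phi n)‖ₑ ^ 2 *
          ∫⁻ t in Icc 0 T, absConv (mlKernel α (lam n)) h T t ^ 2) +
        2 * (‖inner ℝ g (phi n)‖ₑ ^ 2 * ENNReal.ofReal (wienerBound α T)) *
          ENNReal.ofReal T) := by
        rw [lintegral_tsum fun n =>
          ((((hV n).restrict.pow_const 2).const_mul _).const_mul _).add_const _]
        refine tsum_congr fun n => ?_
        rw [lintegral_add_right _ measurable_const, lintegral_const_mul' _ _ (by simp),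
          lintegral_const_mul' _ _ (by simp), lintegral_const]
        simp
    _ ≤ ∑' n, (2 * (‖inner ℝ f (phi n)‖ₑ ^ 2 * (ENNReal.ofReal (1 / l0) ^ 2 *
          eLpNorm h 2 (volume.restrict (Icc 0 T)) ^ 2)) +
        2 * (‖inner ℝ g (phi n)‖ₑ ^ 2 * ENNReal.ofReal (wienerBound α T)) *
          ENNReal.ofReal T) := by
        refine ENNReal.tsum_le_tsum fun n => ?_
        gcongr
        refine (lintegral_absConv_sq_le (measurable_mlKernel hα0) hh.1.aemeasurable).trans ?_
        gcongr
        exact lintegral_enorm_mlKernel_le hα hT hl0 (hlam n)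
    _ = _ := by
        rw [ENNReal.tsum_add, ENNReal.tsum_mul_left, ENNReal.tsum_mul_right, ENNReal.tsum_mul_right,
          ENNReal.tsum_mul_left, ENNReal.tsum_mul_right, ← enorm_sq_eq_tsum_inner,
          ← enorm_sq_eq_tsum_inner]

end Mild

end SFDE

end

/-! ### The constant and the conclusion -/

theorem mainTheorem5 {d : ℕ} (D : Set (SFDE.Space d)) (hD : IsOpen D)
    (hDb : Bornology.IsBounded D) (A : SFDE.DiffOp d) (hA : A.IsSymmEllipticPosDef D)
    (α : ℝ) (hα : α ∈ Set.Ioo (1 / 2 : ℝ) 1) :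
    ∃ C : ℝ, 0 < C ∧
      ∀ (lam : ℕ → ℝ) (phi : HilbertBasis ℕ ℝ (SFDE.L2 D)), A.IsEigensystem D lam phi →
      ∀ (T : ℝ), 0 < T →
      ∀ (f g : SFDE.L2 D) (h : ℝ → ℝ), MemLp h ∞ (volume.restrict (Set.Icc 0 T)) →
      ∀ (Ω : Type*) [MeasurableSpace Ω] (P : Measure Ω) [IsProbabilityMeasure P]
        (W : ℝ≥0 → Ω → ℝ), IsBrownianReal W P →
        (∃ u : ℝ → Ω → SFDE.L2 D, SFDE.IsMildSolution α lam phi T f g h P W u) ∧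
        ∀ u : ℝ → Ω → SFDE.L2 D, SFDE.IsMildSolution α lam phi T f g h P W u →
          SFDE.expectedSqNorm T P u ≤
            ENNReal.ofReal C *
              (eLpNorm h 2 (volume.restrict (Set.Icc 0 T)) ^ 2 * ‖f‖ₑ ^ 2
                + ENNReal.ofReal (T ^ (2 * α)) * ‖g‖ₑ ^ 2) := by
  -- C must precede the eigensystem. It is built from the lowest eigenvalue of one fixed
  -- eigensystem, which bounds all others; if there is none, any C works.
  by_cases hex : ∃ (mu : ℕ → ℝ) (psi : HilbertBasis ℕ ℝ (SFDE.L2 D)), A.IsEigensystem D mu psi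
  swap
  · exact ⟨1, one_pos, fun lam phi hE => (hex ⟨lam, phi, hE⟩).elim⟩
  obtain ⟨mu, psi, hmu⟩ := hex
  have hl0 : 0 < mu 0 := hmu.pos hA 0
  have hα2 : 0 < 2 * α - 1 := by linarith [hα.1]
  have hG : 0 < Real.Gamma α := Real.Gamma_pos_of_pos (by linarith [hα.1])
  set C₁ : ℝ := 2 * (1 / mu 0) ^ 2 with hC₁
  set C₂ : ℝ := 2 / ((2 * α - 1) * Real.Gamma α ^ 2) with hC₂
  have hC₁0 : 0 < C₁ := by positivity
  have hC₂0 : 0 < C₂ := by positivity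
  refine ⟨C₁ + C₂, by positivity, fun lam phi hE T hT f g h hh Ω _ P _ W hW => ?_⟩
  have hlam : ∀ n, mu 0 ≤ lam n := hmu.le hE hA
  refine ⟨SFDE.exists_isMildSolution hW hα hT hl0 hlam hh, fun u hu => ?_⟩
  refine (hu.expectedSqNorm_le hW hα hT hl0 hlam hh).trans ?_
  rw [mul_add]
  refine add_le_add ?_ ?_
  · calc 2 * (‖f‖ₑ ^ 2 * (ENNReal.ofReal (1 / mu 0) ^ 2 *
          eLpNorm h 2 (volume.restrict (Set.Icc 0 T)) ^ 2))
        = ENNReal.ofReal C₁ *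
          (eLpNorm h 2 (volume.restrict (Set.Icc 0 T)) ^ 2 * ‖f‖ₑ ^ 2) := by
          rw [hC₁, ENNReal.ofReal_mul (by norm_num), ENNReal.ofReal_pow (by positivity),
            ENNReal.ofReal_ofNat]
          ring
      _ ≤ _ := by
          gcongr
          linarith
  · calc 2 * (‖g‖ₑ ^ 2 * ENNReal.ofReal (SFDE.wienerBound α T)) * ENNReal.ofReal T
        = ENNReal.ofReal C₂ * (ENNReal.ofReal (T ^ (2 * α)) * ‖g‖ₑ ^ 2) := by
          -- The second-moment bound has order T^(2α-1); integration in time supplies the missing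
          -- factor T.
          have hval : C₂ * T ^ (2 * α) = 2 * SFDE.wienerBound α T * T := by
            rw [hC₂, SFDE.wienerBound, show 2 * α = 2 * α - 1 + 1 by ring,
              Real.rpow_add_one hT.ne', add_sub_cancel_right]
            ring
          have hwb : 0 ≤ SFDE.wienerBound α T := by
            unfold SFDE.wienerBound
            positivity
          rw [← mul_assoc (ENNReal.ofReal C₂), ← ENNReal.ofReal_mul hC₂0.le, hval,
            ENNReal.ofReal_mul (by positivity), ENNReal.ofReal_mul (by norm_num),
            ENNReal.ofReal_ofNat]
          ring
      _ ≤ _ := by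
          gcongr
          linarith
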